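/- Let $F$ be a field of characteristic $2$ and let $A$ be a biquaternion division algebra over $F$, i.e. a division algebra isomorphic over $F$ to $[\alpha,\beta)\otimes_F[\gamma,\delta)$ for some $\alpha,\gamma\in F$ and $\beta,\delta\in F^\times$, where $[\alpha,\beta)=F[x,y : x^2+x=\alpha,\ y^2=\beta,\ xy+yx=y]$. A quadruple of generators of $A$ is a quadruple $(x,y,z,u)$ of elements generating $A$ as an $F$-algebra such that $x^2+x,\ y^2,\ z^2+z,\ u^2\in F$, $xy+yx=y$, $zu+uz=u$, and each of $x,y$ commutes with each of $z,u$; its two pairs are $(x,y)$ and $(z,u)$, and the order of the pairs is disregarded, i.e. $(x,y,z,u)$ and $(z,u,x,y)$ are identified. A step from one quadruple of generators to another is of type $\Pi$ if at most one pair is changed, and of type $\Lambda_2$ if at most one generator is changed in each pair. Then any two quadruples of generators of $A$ are connected by a chain consisting (in some order) of at most $9$ steps of type $\Pi$ and at most $6$ steps of type $\Lambda_2$. In particular, any two quadruples of generators of $A$ are connected by a chain of at most fifteen steps, each of which keeps at least two of the four entries unchanged. -/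

import Mathlib

open scoped TensorProduct Quaternion

namespace Biquaternion

/-- In characteristic `2`, `ℍ[F, α, 1, β]` is the quaternion algebra `[α, β)`: it has generators
`i`, `j` with `i² = α + i`, `j² = β`, `i j + j i = j`.  A biquaternion algebra is a tensor product
of two such algebras. -/
def IsBiquaternionAlgebra (F A : Type*) [Field F] [Ring A] [Algebra F A] : Prop :=
  ∃ α β γ δ : F, β ≠ 0 ∧ δ ≠ 0 ∧
    Nonempty (A ≃ₐ[F] (ℍ[F, α, 1, β] ⊗[F] ℍ[F, γ, 1, δ]))

/-- An ordered quadruple of (standard) generators `(x, y, z, u)` of `A`. -/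
@[ext]
structure OrderedQuadruple (F A : Type*) [Field F] [Ring A] [Algebra F A] where
  x : A
  y : A
  z : A
  u : A
  artinSchreier_x : ∃ α : F, x ^ 2 + x = algebraMap F A α
  squareCentral_y : ∃ β : F, y ^ 2 = algebraMap F A β
  artinSchreier_z : ∃ γ : F, z ^ 2 + z = algebraMap F A γ
  squareCentral_u : ∃ δ : F, u ^ 2 = algebraMap F A δ
  xy_add_yx : x * y + y * x = y
  zu_add_uz : z * u + u * z = u
  xz_eq_zx : x * z = z * x
  xu_eq_ux : x * u = u * x
  yz_eq_zy : y * z = z * y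
  yu_eq_uy : y * u = u * y
  generates : Algebra.adjoin F {x, y, z, u} = ⊤

namespace OrderedQuadruple

variable {F A : Type*} [Field F] [Ring A] [Algebra F A]

/-- Interchange the two pairs: `(x, y, z, u) ↦ (z, u, x, y)`. -/
def swap (q : OrderedQuadruple F A) : OrderedQuadruple F A where
  x := q.z
  y := q.u
  z := q.x
  u := q.y
  artinSchreier_x := q.artinSchreier_z
  squareCentral_y := q.squareCentral_u
  artinSchreier_z := q.artinSchreier_x
  squareCentral_u := q.squareCentral_y
  xy_add_yx := q.zu_add_uz
  zu_add_uz := q.xy_add_yx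
  xz_eq_zx := q.xz_eq_zx.symm
  xu_eq_ux := q.yz_eq_zy.symm
  yz_eq_zy := q.xu_eq_ux.symm
  yu_eq_uy := q.yu_eq_uy.symm
  generates := by
    rw [← q.generates]
    congr 1
    ext a
    simp only [Set.mem_insert_iff, Set.mem_singleton_iff]
    tauto

theorem swap_swap (q : OrderedQuadruple F A) : q.swap.swap = q := rfl

/-- The entries `x, y, z, u`, numbered `0, 1, 2, 3`. -/
def entry (q : OrderedQuadruple F A) : Fin 4 → A := ![q.x, q.y, q.z, q.u]

/-- Quadruples are considered up to the order of the two pairs. -/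
instance setoid (F A : Type*) [Field F] [Ring A] [Algebra F A] :
    Setoid (OrderedQuadruple F A) where
  r q q' := q' = q ∨ q' = q.swap
  iseqv :=
    { refl := fun _ => Or.inl rfl
      symm := by
        rintro q q' (h | h)
        · exact Or.inl h.symm
        · exact Or.inr (by rw [h, swap_swap])
      trans := by
        rintro q q' q'' (h | h) (h' | h')
        · exact Or.inl (h'.trans h)
        · exact Or.inr (by rw [h', h])
        · exact Or.inr (by rw [h', h])
        · exact Or.inl (by rw [h', h, swap_swap]) }

end OrderedQuadruple

/-- Quadruples of generators of `A`, with `(x, y, z, u)` and `(z, u, x, y)` identified. -/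
def Quadruple (F A : Type*) [Field F] [Ring A] [Algebra F A] : Type _ :=
  Quotient (OrderedQuadruple.setoid F A)

section Steps

variable {F A : Type*} [Field F] [Ring A] [Algebra F A]

/-- The quadruple of generators given by an ordered quadruple. -/
def OrderedQuadruple.toQuadruple (q : OrderedQuadruple F A) : Quadruple F A :=
  Quotient.mk (OrderedQuadruple.setoid F A) q

/-- A step of type `Π`: at most one pair is changed. -/
def StepPi (p p' : Quadruple F A) : Prop :=
  ∃ q q' : OrderedQuadruple F A, q.toQuadruple = p ∧ q'.toQuadruple = p' ∧
    ((q.x = q'.x ∧ q.y = q'.y) ∨ (q.z = q'.z ∧ q.u = q'.u))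

/-- A step of type `Λ₂`: at most one generator is changed in each pair. -/
def StepLambdaTwo (p p' : Quadruple F A) : Prop :=
  ∃ q q' : OrderedQuadruple F A, q.toQuadruple = p ∧ q'.toQuadruple = p' ∧
    ((q.x = q'.x ∨ q.y = q'.y) ∧ (q.z = q'.z ∨ q.u = q'.u))

/-- A step that keeps (at least) two entries unchanged. -/
def StepKeepsTwo (p p' : Quadruple F A) : Prop :=
  ∃ q q' : OrderedQuadruple F A, q.toQuadruple = p ∧ q'.toQuadruple = p' ∧
    ∃ i j : Fin 4, i ≠ j ∧ q.entry i = q'.entry i ∧ q.entry j = q'.entry j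

/-- `Chain m n p p'`: there is a chain from `p` to `p'` consisting, in some order, of `m` steps of
type `Π` and `n` steps of type `Λ₂`. -/
inductive Chain : ℕ → ℕ → Quadruple F A → Quadruple F A → Prop
  | nil (p : Quadruple F A) : Chain 0 0 p p
  | stepPi {m n : ℕ} {p p' p'' : Quadruple F A} :
      Chain m n p p' → StepPi p' p'' → Chain (m + 1) n p p''
  | stepLambdaTwo {m n : ℕ} {p p' p'' : Quadruple F A} :
      Chain m n p p' → StepLambdaTwo p' p'' → Chain m (n + 1) p p''

end Steps

end Biquaternion

/-! A quadruple of generators can be recorded by vectors of a six-dimensional quadratic space, where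
the chain lemma becomes linear algebra. On the Albert space V of A there are two linear embeddings
`i`, `p` into A with `i v * p v = p v * i v = quad v`; since A is a division algebra, `quad` is
anisotropic. The products `i v * p w` obey Clifford-type rules: such a product has trace `form v w`
and norm `quad v * quad w`, and products from orthogonal pairs commute. Hence two orthogonal
hyperbolic pairs (v₁, w₁), (v₂, w₂) and a nonzero n orthogonal to both give a quadruple with x =
[v₁, w₁], y = [v₁, n], z = [v₂, w₂], u = [v₂, n].

Every quadruple arises so (`OrderedQuadruple.exists_frame`). If σ is the tensor product of the
canonical involutions, all a + σ a lie in i(V). A Skolem–Noether argument gives a σ-fixed s ≠ 0 such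
that a ↦ s σ(a) s⁻¹ sends x, z to x + 1, z + 1 and fixes y, u. Then s, ys, yxs, us, uzs lie in i(V);
s is the image of n, and the others yield the two pairs.

Steps are now geometric. Changing n alone keeps x and z, so it is of type Λ₂; changing one
hyperbolic pair alone is of type Π. Two frames sharing a pair are joined by 3 steps Π and 2 steps Λ₂
(`chain_of_first_eq`). At the same cost, the second pair of any frame can be made orthogonal to a
prescribed hyperbolic pair (`exists_chain_perp`). One use of the latter and two of the former give 9
and 6. -/

namespace Biquaternion

/-! ### Independence of the sixteen standard products, and nonvanishing of y and u -/

section Generation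

variable {F A : Type*} [Field F] [DivisionRing A] [Algebra F A] [CharP A 2]

theorem not_mem_range_of_artinSchreier {x y : A} (hxy : x * y + y * x = y) (hy : y ≠ 0) (c : F) :
    x ≠ algebraMap F A c := by
  rintro rfl
  rw [← Algebra.commutes c y, CharTwo.add_self_eq_zero] at hxy
  exact hy hxy.symm

/-- The commutator with x kills a + bx and, since [x, y] = y, turns the rest into (c + dx)y. The
commutator with y then turns a + bx into by, and likewise for c + dx. -/
theorem eq_zero_of_quaternion_relation {x y a b c d : A} (hxy : x * y + y * x = y) (hy : y ≠ 0)
    (ha : Commute a x ∧ Commute a y) (hb : Commute b x ∧ Commute b y)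
    (hc : Commute c x ∧ Commute c y) (hd : Commute d x ∧ Commute d y)
    (h : a + b * x + c * y + d * (x * y) = 0) : a = 0 ∧ b = 0 ∧ c = 0 ∧ d = 0 := by
  have key : ∀ a b : A, Commute b y → Commute a y → a + b * x = 0 → a = 0 ∧ b = 0 := by
    intro a b hb ha h
    have h1 : b * y = 0 := by
      calc b * y = b * (x * y + y * x) + (a * y + a * y) := by
            rw [hxy, CharTwo.add_self_eq_zero, add_zero]
        _ = (a + b * x) * y + (y * a + y * b * x) := by
            rw [← hb.eq, ← ha.eq]; noncomm_ring
        _ = (a + b * x) * y + y * (a + b * x) := by noncomm_ring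
        _ = 0 := by rw [h]; simp
    have hb0 : b = 0 := (mul_eq_zero.1 h1).resolve_right hy
    exact ⟨by simpa [hb0] using h, hb0⟩
  have h2 : (c + d * x) * y = 0 := by
    calc (c + d * x) * y = c * (x * y + y * x) + d * x * (x * y + y * x) := by
          rw [hxy]; noncomm_ring
      _ = x * (c * y + d * (x * y)) + (c * y + d * (x * y)) * x := by
          have e1 := hc.1.eq
          have e2 := hd.1.eq
          simp only [mul_add, add_mul, ← mul_assoc, ← e1, ← e2]
          abel
      _ = x * (a + b * x + c * y + d * (x * y)) + (a + b * x + c * y + d * (x * y)) * x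
            + ((x * a + a * x) + (x * b + b * x) * x) := by
          have e : ∀ t : A, x * t + t * x
              = x * (a + b * x + t) + (a + b * x + t) * x + ((x * a + a * x) + (x * b + b * x) * x)
                - ((x * a + a * x) + (x * a + a * x))
                - ((x * b + b * x) * x + (x * b + b * x) * x) := by
            intro t; noncomm_ring
          rw [e]
          simp only [CharTwo.add_self_eq_zero, sub_zero, add_assoc]
      _ = 0 := by
          rw [h, ← ha.1.eq, ← hb.1.eq, CharTwo.add_self_eq_zero, CharTwo.add_self_eq_zero]
          simp
  obtain ⟨hc0, hd0⟩ := key c d hd.2 hc.2 ((mul_eq_zero.1 h2).resolve_right hy)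
  rw [hc0, hd0] at h
  obtain ⟨ha0, hb0⟩ := key a b hb.2 ha.2 (by simpa using h)
  exact ⟨ha0, hb0, hc0, hd0⟩

/-- Applying the quaternion relation lemma twice, first with coefficients in the span of 1, z, u, zu
and then with scalars, makes the sixteen products independent, hence a basis. -/
theorem adjoin_eq_top_of_relations (hfin : Module.finrank F A = 16) {x y z u : A}
    (hxy : x * y + y * x = y) (hzu : z * u + u * z = u) (hxz : x * z = z * x) (hxu : x * u = u * x)
    (hyz : y * z = z * y) (hyu : y * u = u * y) (hy : y ≠ 0) (hu : u ≠ 0) :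
    Algebra.adjoin F {x, y, z, u} = ⊤ := by
  let e : Fin 4 → A := ![1, z, u, z * u]
  let f : Fin 4 → A := ![1, x, y, x * y]
  have hli : LinearIndependent F fun ij : Fin 4 × Fin 4 => e ij.2 * f ij.1 := by
    rw [Fintype.linearIndependent_iff]
    intro g hg
    rw [Fintype.sum_prod_type] at hg
    have hcomm : ∀ i, Commute (∑ j, g (i, j) • e j) x ∧ Commute (∑ j, g (i, j) • e j) y := by
      intro i
      have hz' : Commute z x ∧ Commute z y := ⟨hxz.symm, hyz.symm⟩
      have hu' : Commute u x ∧ Commute u y := ⟨hxu.symm, hyu.symm⟩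
      have he : ∀ j, Commute (e j) x ∧ Commute (e j) y := by
        intro j
        fin_cases j
        · exact ⟨Commute.one_left _, Commute.one_left _⟩
        · exact hz'
        · exact hu'
        · exact ⟨hz'.1.mul_left hu'.1, hz'.2.mul_left hu'.2⟩
      exact ⟨Commute.sum_left _ _ _ fun j _ => (he j).1.smul_left _,
        Commute.sum_left _ _ _ fun j _ => (he j).2.smul_left _⟩
    have h1 : ∑ i, (∑ j, g (i, j) • e j) * f i = 0 := by
      rw [← hg]
      refine Finset.sum_congr rfl fun i _ => ?_
      rw [Finset.sum_mul]
      exact Finset.sum_congr rfl fun j _ => smul_mul_assoc _ _ _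
    rw [Fin.sum_univ_four] at h1
    obtain ⟨h00, h01, h02, h03⟩ := eq_zero_of_quaternion_relation hxy hy (hcomm 0) (hcomm 1)
      (hcomm 2) (hcomm 3) (by simpa [f] using h1)
    have h2 : ∀ i, ∑ j, g (i, j) • e j = 0 := by
      intro i; fin_cases i <;> assumption
    have hF : ∀ c : F, Commute (algebraMap F A c) z ∧ Commute (algebraMap F A c) u := fun c =>
      ⟨Algebra.commutes c z, Algebra.commutes c u⟩
    rintro ⟨i, j⟩
    have h3 := h2 i
    rw [Fin.sum_univ_four] at h3
    have h4 := eq_zero_of_quaternion_relation hzu hu (hF (g (i, 0))) (hF (g (i, 1)))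
      (hF (g (i, 2))) (hF (g (i, 3))) (by simpa [e, Algebra.smul_def] using h3)
    simp only [map_eq_zero] at h4
    obtain ⟨h40, h41, h42, h43⟩ := h4
    fin_cases j <;> assumption
  have hspan := hli.span_eq_top_of_card_eq_finrank (by simp [hfin])
  rw [eq_top_iff]
  have hx' : x ∈ Algebra.adjoin F {x, y, z, u} := Algebra.subset_adjoin (by simp)
  have hy' : y ∈ Algebra.adjoin F {x, y, z, u} := Algebra.subset_adjoin (by simp)
  have hz' : z ∈ Algebra.adjoin F {x, y, z, u} := Algebra.subset_adjoin (by simp)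
  have hu' : u ∈ Algebra.adjoin F {x, y, z, u} := Algebra.subset_adjoin (by simp)
  rw [← Subalgebra.toSubmodule.le_iff_le, Algebra.top_toSubmodule, ← hspan, Submodule.span_le]
  rintro _ ⟨⟨i, j⟩, rfl⟩
  refine (mul_mem ?_ ?_ : _ ∈ Algebra.adjoin F {x, y, z, u})
  · fin_cases j
    · exact one_mem _
    · exact hz'
    · exact hu'
    · exact mul_mem hz' hu'
  · fin_cases i
    · exact one_mem _
    · exact hx'
    · exact hy'
    · exact mul_mem hx' hy'

/-- The span of the eight listed monomials contains 1 and is stable under left multiplication by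
each generator. This excludes y = 0 in a quadruple. -/
theorem finrank_adjoin_le_eight {x z u : A} {α γ δ : F} (hx : x ^ 2 + x = algebraMap F A α)
    (hz : z ^ 2 + z = algebraMap F A γ) (hu : u ^ 2 = algebraMap F A δ)
    (hzu : z * u + u * z = u) (hxz : x * z = z * x) (hxu : x * u = u * x)
    (h : Algebra.adjoin F {x, z, u} = ⊤) : Module.finrank F A ≤ 8 := by
  let m : Fin 8 → A := ![1, z, u, z * u, x, x * z, x * u, x * (z * u)]
  let S := Submodule.span F (Set.range m)
  have hm : ∀ i, m i ∈ S := fun i => Submodule.subset_span ⟨i, rfl⟩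
  have two (a : A) : a + a = 0 := CharTwo.add_self_eq_zero a
  have hx2 : x * x = α • 1 + x := by
    rw [← Algebra.algebraMap_eq_smul_one, ← hx, add_assoc, two, add_zero, sq]
  have hz2 : z * z = γ • 1 + z := by
    rw [← Algebra.algebraMap_eq_smul_one, ← hz, add_assoc, two, add_zero, sq]
  have hu2 : u * u = δ • 1 := by rw [← Algebra.algebraMap_eq_smul_one, ← hu, sq]
  have huz : u * z = z * u + u := by
    calc u * z = z * u + (z * u + u * z) := by rw [← add_assoc, two, zero_add]
      _ = _ := by rw [hzu]
  have hstable : ∀ a : A, (∀ i, a * m i ∈ S) → ∀ s ∈ S, a * s ∈ S := by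
    intro a ha s hs
    induction hs using Submodule.span_induction with
    | mem s hs => obtain ⟨i, rfl⟩ := hs; exact ha i
    | zero => simp
    | add s t _ _ h1 h2 => rw [mul_add]; exact add_mem h1 h2
    | smul c s _ h => rw [mul_smul_comm]; exact S.smul_mem c h
  have hSx : ∀ s ∈ S, x * s ∈ S := by
    refine hstable x fun i => ?_
    have hxx (b : A) : x * (x * b) = α • b + x * b := by
      rw [← mul_assoc, hx2, add_mul, smul_mul_assoc, one_mul]
    fin_cases i
    · simpa [m] using hm 4
    · exact hm 5
    · exact hm 6
    · exact hm 7
    · change x * x ∈ S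
      rw [hx2]; exact add_mem (S.smul_mem _ (hm 0)) (hm 4)
    · change x * (x * z) ∈ S
      rw [hxx]; exact add_mem (S.smul_mem _ (hm 1)) (hm 5)
    · change x * (x * u) ∈ S
      rw [hxx]; exact add_mem (S.smul_mem _ (hm 2)) (hm 6)
    · change x * (x * (z * u)) ∈ S
      rw [hxx]; exact add_mem (S.smul_mem _ (hm 3)) (hm 7)
  have hz4 : z * 1 ∈ S ∧ z * z ∈ S ∧ z * u ∈ S ∧ z * (z * u) ∈ S := by
    refine ⟨by simpa [m] using hm 1, ?_, hm 3, ?_⟩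
    · rw [hz2]; exact add_mem (S.smul_mem _ (hm 0)) (hm 1)
    · rw [← mul_assoc, hz2, add_mul, smul_mul_assoc, one_mul]
      exact add_mem (S.smul_mem _ (hm 2)) (hm 3)
  have hu4 : u * 1 ∈ S ∧ u * z ∈ S ∧ u * u ∈ S ∧ u * (z * u) ∈ S := by
    refine ⟨by simpa [m] using hm 2, ?_, ?_, ?_⟩
    · rw [huz]; exact add_mem (hm 3) (hm 2)
    · rw [hu2]; exact S.smul_mem _ (hm 0)
    · rw [← mul_assoc, huz, add_mul, mul_assoc, hu2, mul_smul_comm, mul_one]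
      exact add_mem (S.smul_mem _ (hm 1)) (S.smul_mem _ (hm 0))
  have hcommx : ∀ t b : A, x * t = t * x → t * b ∈ S → t * (x * b) ∈ S := by
    intro t b ht hb
    rw [← mul_assoc, ← ht, mul_assoc]
    exact hSx _ hb
  have hSz : ∀ s ∈ S, z * s ∈ S := by
    refine hstable z fun i => ?_
    fin_cases i
    · exact hz4.1
    · exact hz4.2.1
    · exact hz4.2.2.1
    · exact hz4.2.2.2
    · simpa [m] using hcommx z 1 hxz hz4.1
    · exact hcommx z _ hxz hz4.2.1
    · exact hcommx z _ hxz hz4.2.2.1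
    · exact hcommx z _ hxz hz4.2.2.2
  have hSu : ∀ s ∈ S, u * s ∈ S := by
    refine hstable u fun i => ?_
    fin_cases i
    · exact hu4.1
    · exact hu4.2.1
    · exact hu4.2.2.1
    · exact hu4.2.2.2
    · simpa [m] using hcommx u 1 hxu hu4.1
    · exact hcommx u _ hxu hu4.2.1
    · exact hcommx u _ hxu hu4.2.2.1
    · exact hcommx u _ hxu hu4.2.2.2
  have htop : S = ⊤ := by
    rw [eq_top_iff]
    intro a _
    have ha : a ∈ Algebra.adjoin F {x, z, u} := h ▸ Algebra.mem_top
    have hl : ∀ s ∈ S, a * s ∈ S := by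
      clear * - ha hSx hSz hSu
      induction ha using Algebra.adjoin_induction with
      | mem a ha =>
        rcases ha with rfl | rfl | rfl
        · exact hSx
        · exact hSz
        · exact hSu
      | algebraMap c =>
        intro s hs
        rw [← Algebra.smul_def]
        exact S.smul_mem _ hs
      | add a b _ _ h1 h2 =>
        intro s hs
        rw [add_mul]
        exact add_mem (h1 s hs) (h2 s hs)
      | mul a b _ _ h1 h2 =>
        intro s hs
        rw [mul_assoc]
        exact h1 _ (h2 s hs)
    simpa using hl 1 (hm 0)
  rw [← finrank_top F A, ← htop]
  exact (finrank_range_le_card m).trans (by simp)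

theorem OrderedQuadruple.y_ne_zero (hfin : Module.finrank F A = 16) (q : OrderedQuadruple F A) :
    q.y ≠ 0 := by
  intro hy
  obtain ⟨α, hα⟩ := q.artinSchreier_x
  obtain ⟨γ, hγ⟩ := q.artinSchreier_z
  obtain ⟨δ, hδ⟩ := q.squareCentral_u
  have h : Algebra.adjoin F {q.x, q.z, q.u} = ⊤ := by
    rw [eq_top_iff, ← q.generates]
    refine Algebra.adjoin_le ?_
    rintro a (rfl | rfl | rfl | rfl)
    · exact Algebra.subset_adjoin (by simp)
    · rw [hy]; exact zero_mem _
    · exact Algebra.subset_adjoin (by simp)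
    · exact Algebra.subset_adjoin (by simp)
  have := finrank_adjoin_le_eight hα hγ hδ q.zu_add_uz q.xz_eq_zx q.xu_eq_ux h
  omega

theorem OrderedQuadruple.u_ne_zero (hfin : Module.finrank F A = 16) (q : OrderedQuadruple F A) :
    q.u ≠ 0 := q.swap.y_ne_zero hfin

end Generation

/-- A six-dimensional space carrying a nondegenerate quadratic form, embedded in `A` in two ways
`i, p` such that the products `i v * p v` and `p v * i v` are the values of the form. -/
structure AlbertSpace (F A V : Type*) [Field F] [Ring A] [Algebra F A] [AddCommGroup V]
    [Module F V] where
  i : V →ₗ[F] A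
  p : V →ₗ[F] A
  form : V →ₗ[F] V →ₗ[F] F
  quad : V → F
  i_mul_p_add : ∀ v w, i v * p w + i w * p v = algebraMap F A (form v w)
  p_mul_i_add : ∀ v w, p v * i w + p w * i v = algebraMap F A (form v w)
  i_mul_p : ∀ v, i v * p v = algebraMap F A (quad v)
  p_mul_i : ∀ v, p v * i v = algebraMap F A (quad v)
  i_injective : Function.Injective i
  p_injective : Function.Injective p
  nondegenerate : ∀ v, (∀ w, form v w = 0) → v = 0
  finrank_eq : Module.finrank F V = 6

/-! ### Multiplication rules for the products `i v * p w` -/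

namespace AlbertSpace

variable {F A V : Type*} [Field F] [DivisionRing A] [Algebra F A] [AddCommGroup V] [Module F V]
  (S : AlbertSpace F A V)

theorem form_comm (v w : V) : S.form v w = S.form w v := by
  apply (algebraMap F A).injective
  rw [← S.i_mul_p_add, ← S.i_mul_p_add, add_comm]

theorem form_self [CharP A 2] (v : V) : S.form v v = 0 := by
  apply (algebraMap F A).injective
  rw [← S.i_mul_p_add, CharTwo.add_self_eq_zero, map_zero]

theorem i_ne_zero {v : V} (hv : v ≠ 0) : S.i v ≠ 0 := by
  rwa [Ne, map_eq_zero_iff _ S.i_injective]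

theorem p_ne_zero {v : V} (hv : v ≠ 0) : S.p v ≠ 0 := by
  rwa [Ne, map_eq_zero_iff _ S.p_injective]

theorem quad_ne_zero {v : V} (hv : v ≠ 0) : S.quad v ≠ 0 := by
  intro h
  have h' := S.i_mul_p v
  rw [h, map_zero] at h'
  exact mul_ne_zero (S.i_ne_zero hv) (S.p_ne_zero hv) h'

/-- The element of `A` attached to an ordered pair of vectors. -/
def bracket (v w : V) : A := S.i v * S.p w

theorem bracket_ne_zero {v w : V} (hv : v ≠ 0) (hw : w ≠ 0) : S.bracket v w ≠ 0 :=
  mul_ne_zero (S.i_ne_zero hv) (S.p_ne_zero hw)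

variable [CharP A 2]

theorem i_mul_p_swap (v w : V) : S.i v * S.p w = algebraMap F A (S.form v w) + S.i w * S.p v := by
  rw [← S.i_mul_p_add, add_assoc, CharTwo.add_self_eq_zero, add_zero]

theorem p_mul_i_swap (v w : V) : S.p v * S.i w = algebraMap F A (S.form v w) + S.p w * S.i v := by
  rw [← S.p_mul_i_add, add_assoc, CharTwo.add_self_eq_zero, add_zero]

theorem i_mul_p_comm {v w : V} (h : S.form v w = 0) : S.i v * S.p w = S.i w * S.p v := by
  rw [S.i_mul_p_swap, h, map_zero, zero_add]

theorem p_mul_i_comm {v w : V} (h : S.form v w = 0) : S.p v * S.i w = S.p w * S.i v := by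
  rw [S.p_mul_i_swap, h, map_zero, zero_add]

theorem bracket_sq (v w : V) : S.bracket v w ^ 2 =
    algebraMap F A (S.form v w) * S.bracket v w + algebraMap F A (S.quad v * S.quad w) := by
  have h1 : S.bracket v w ^ 2 = S.i v * (S.p w * S.i v) * S.p w := by
    rw [bracket, sq]; noncomm_ring
  rw [h1, S.p_mul_i_swap, S.form_comm w v, bracket, mul_add, add_mul, ← Algebra.commutes,
    mul_assoc (algebraMap F A _), ← mul_assoc (S.i v), S.i_mul_p, mul_assoc, S.i_mul_p, map_mul]

/-- Each of c, d is moved past each of a, b; orthogonality removes the scalar correction of every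
exchange. -/
theorem bracket_commute {a b c d : V} (hac : S.form a c = 0) (had : S.form a d = 0)
    (hbc : S.form b c = 0) (hbd : S.form b d = 0) :
    S.bracket a b * S.bracket c d = S.bracket c d * S.bracket a b := by
  calc S.bracket a b * S.bracket c d = S.i a * (S.p b * S.i c) * S.p d := by
        rw [bracket, bracket]; noncomm_ring
    _ = (S.i a * S.p c) * (S.i b * S.p d) := by rw [S.p_mul_i_comm hbc]; noncomm_ring
    _ = S.i c * (S.p a * S.i d) * S.p b := by
        rw [S.i_mul_p_comm hac, S.i_mul_p_comm hbd]; noncomm_ring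
    _ = S.bracket c d * S.bracket a b := by
        rw [S.p_mul_i_comm had, bracket, bracket]; noncomm_ring

theorem bracket_mul_bracket_same (a c n : V) (hcn : S.form n c = 0) :
    S.bracket a n * S.bracket c n = algebraMap F A (S.quad n) * (S.i a * S.p c) := by
  calc S.bracket a n * S.bracket c n = S.i a * (S.p n * S.i c) * S.p n := by
        rw [bracket, bracket]; noncomm_ring
    _ = S.i a * S.p c * (S.i n * S.p n) := by rw [S.p_mul_i_comm hcn]; noncomm_ring
    _ = _ := by rw [S.i_mul_p, Algebra.commutes]

/-- Up to the nonzero scalar `quad n` the two products are `i a * p c` and `i c * p a`, which differ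
by `form a c`. The converse direction recovers orthogonality from commuting generators. -/
theorem bracket_commute_same_iff {a c n : V} (hn : n ≠ 0) (han : S.form n a = 0)
    (hcn : S.form n c = 0) : S.bracket a n * S.bracket c n = S.bracket c n * S.bracket a n ↔
      S.form a c = 0 := by
  have hq : algebraMap F A (S.quad n) ≠ 0 := by
    rw [Ne, map_eq_zero]; exact S.quad_ne_zero hn
  rw [S.bracket_mul_bracket_same _ _ _ hcn, S.bracket_mul_bracket_same _ _ _ han,
    mul_right_inj' hq, S.i_mul_p_swap, add_eq_right, map_eq_zero]

theorem bracket_artinSchreier {v w n : V} (hvw : S.form v w = 1) (hvn : S.form v n = 0)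
    (hwn : S.form w n = 0) : S.bracket v w * S.bracket v n + S.bracket v n * S.bracket v w =
      S.bracket v n := by
  have h1 : S.bracket v n * S.bracket v w = algebraMap F A (S.quad v) * (S.i w * S.p n) := by
    calc S.bracket v n * S.bracket v w = S.i v * (S.p n * S.i v) * S.p w := by
          rw [bracket, bracket]; noncomm_ring
      _ = (S.i v * S.p v) * (S.i n * S.p w) := by
          rw [S.p_mul_i_comm (by rw [S.form_comm, hvn])]; noncomm_ring
      _ = _ := by rw [S.i_mul_p, S.i_mul_p_comm hwn]
  have h2 : S.bracket v w * S.bracket v n =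
      S.bracket v n + algebraMap F A (S.quad v) * (S.i w * S.p n) := by
    calc S.bracket v w * S.bracket v n = S.i v * (S.p w * S.i v) * S.p n := by
          rw [bracket, bracket]; noncomm_ring
      _ = S.i v * S.p n + (S.i v * S.p v) * (S.i w * S.p n) := by
          rw [S.p_mul_i_swap, S.form_comm, hvw, map_one]; noncomm_ring
      _ = _ := by rw [S.i_mul_p, bracket]
  rw [h1, h2, add_assoc, CharTwo.add_self_eq_zero, add_zero]

end AlbertSpace

/-- Two orthogonal hyperbolic pairs in an Albert space together with a nonzero vector orthogonal
to both. -/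
structure Frame {F A V : Type*} [Field F] [Ring A] [Algebra F A] [AddCommGroup V] [Module F V]
    (S : AlbertSpace F A V) where
  v₁ : V
  w₁ : V
  v₂ : V
  w₂ : V
  n : V
  v₁w₁ : S.form v₁ w₁ = 1
  v₂w₂ : S.form v₂ w₂ = 1
  v₁v₂ : S.form v₁ v₂ = 0
  v₁w₂ : S.form v₁ w₂ = 0
  w₁v₂ : S.form w₁ v₂ = 0
  w₁w₂ : S.form w₁ w₂ = 0
  v₁n : S.form v₁ n = 0
  w₁n : S.form w₁ n = 0
  v₂n : S.form v₂ n = 0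
  w₂n : S.form w₂ n = 0
  n_ne : n ≠ 0

/-! ### Quadruples of frames and the steps between them -/

namespace Frame

variable {F A V : Type*} [Field F] [DivisionRing A] [Algebra F A] [AddCommGroup V] [Module F V]
  {S : AlbertSpace F A V}

/-- Interchange the two hyperbolic pairs. -/
def swap (f : Frame S) : Frame S where
  v₁ := f.v₂
  w₁ := f.w₂
  v₂ := f.v₁
  w₂ := f.w₁
  n := f.n
  v₁w₁ := f.v₂w₂
  v₂w₂ := f.v₁w₁
  v₁v₂ := by rw [S.form_comm, f.v₁v₂]
  v₁w₂ := by rw [S.form_comm, f.w₁v₂]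
  w₁v₂ := by rw [S.form_comm, f.v₁w₂]
  w₁w₂ := by rw [S.form_comm, f.w₁w₂]
  v₁n := f.v₂n
  w₁n := f.w₂n
  v₂n := f.v₁n
  w₂n := f.w₁n
  n_ne := f.n_ne

theorem v₁_ne (f : Frame S) : f.v₁ ≠ 0 := by
  intro h
  have := f.v₁w₁
  simp [h] at this

theorem v₂_ne (f : Frame S) : f.v₂ ≠ 0 := f.swap.v₁_ne

variable [CharP A 2]

theorem bracket_sq_add {v w : V} (h : S.form v w = 1) :
    S.bracket v w ^ 2 + S.bracket v w = algebraMap F A (S.quad v * S.quad w) := by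
  rw [S.bracket_sq, h, map_one, one_mul, add_right_comm, CharTwo.add_self_eq_zero, zero_add]

theorem bracket_sq_of_orthogonal {v w : V} (h : S.form v w = 0) :
    S.bracket v w ^ 2 = algebraMap F A (S.quad v * S.quad w) := by
  rw [S.bracket_sq, h, map_zero, zero_mul, zero_add]

/-- The quadruple of generators attached to a frame. -/
def toOrderedQuadruple (hfin : Module.finrank F A = 16) (f : Frame S) : OrderedQuadruple F A where
  x := S.bracket f.v₁ f.w₁
  y := S.bracket f.v₁ f.n
  z := S.bracket f.v₂ f.w₂
  u := S.bracket f.v₂ f.n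
  artinSchreier_x := ⟨_, bracket_sq_add f.v₁w₁⟩
  squareCentral_y := ⟨_, bracket_sq_of_orthogonal f.v₁n⟩
  artinSchreier_z := ⟨_, bracket_sq_add f.v₂w₂⟩
  squareCentral_u := ⟨_, bracket_sq_of_orthogonal f.v₂n⟩
  xy_add_yx := S.bracket_artinSchreier f.v₁w₁ f.v₁n f.w₁n
  zu_add_uz := S.bracket_artinSchreier f.v₂w₂ f.v₂n f.w₂n
  xz_eq_zx := S.bracket_commute f.v₁v₂ f.v₁w₂ f.w₁v₂ f.w₁w₂
  xu_eq_ux := S.bracket_commute f.v₁v₂ f.v₁n f.w₁v₂ f.w₁n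
  yz_eq_zy := (S.bracket_commute f.swap.v₁v₂ f.v₂n f.swap.w₁v₂ f.w₂n).symm
  yu_eq_uy := (S.bracket_commute_same_iff f.n_ne (by rw [S.form_comm, f.v₁n])
    (by rw [S.form_comm, f.v₂n])).2 f.v₁v₂
  generates := adjoin_eq_top_of_relations hfin
    (S.bracket_artinSchreier f.v₁w₁ f.v₁n f.w₁n) (S.bracket_artinSchreier f.v₂w₂ f.v₂n f.w₂n)
    (S.bracket_commute f.v₁v₂ f.v₁w₂ f.w₁v₂ f.w₁w₂) (S.bracket_commute f.v₁v₂ f.v₁n f.w₁v₂ f.w₁n)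
    (S.bracket_commute f.swap.v₁v₂ f.v₂n f.swap.w₁v₂ f.w₂n).symm
    ((S.bracket_commute_same_iff f.n_ne (by rw [S.form_comm, f.v₁n])
      (by rw [S.form_comm, f.v₂n])).2 f.v₁v₂)
    (S.bracket_ne_zero f.v₁_ne f.n_ne) (S.bracket_ne_zero f.v₂_ne f.n_ne)

/-- The unordered quadruple of generators attached to a frame. -/
def toQuadruple (hfin : Module.finrank F A = 16) (f : Frame S) : Quadruple F A :=
  (f.toOrderedQuadruple hfin).toQuadruple

theorem toQuadruple_swap (hfin : Module.finrank F A = 16) (f : Frame S) :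
    f.swap.toQuadruple hfin = f.toQuadruple hfin :=
  Quotient.sound (Or.inr rfl)

theorem stepPi_of_first_eq (hfin : Module.finrank F A = 16) {f g : Frame S} (hv : f.v₁ = g.v₁)
    (hw : f.w₁ = g.w₁) (hn : f.n = g.n) : StepPi (f.toQuadruple hfin) (g.toQuadruple hfin) :=
  ⟨_, _, rfl, rfl, Or.inl ⟨by simp [toOrderedQuadruple, hv, hw],
    by simp [toOrderedQuadruple, hv, hn]⟩⟩

theorem stepPi_of_second_eq (hfin : Module.finrank F A = 16) {f g : Frame S} (hv : f.v₂ = g.v₂)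
    (hw : f.w₂ = g.w₂) (hn : f.n = g.n) : StepPi (f.toQuadruple hfin) (g.toQuadruple hfin) := by
  rw [← toQuadruple_swap hfin f, ← toQuadruple_swap hfin g]
  exact stepPi_of_first_eq hfin hv hw hn

/-- The vector n enters only y and u, so it may change freely while x and z are kept. -/
theorem stepLambdaTwo_of_eq (hfin : Module.finrank F A = 16) {f g : Frame S} (hv : f.v₁ = g.v₁)
    (hw : f.w₁ = g.w₁) (hv' : f.v₂ = g.v₂) (hw' : f.w₂ = g.w₂) :
    StepLambdaTwo (f.toQuadruple hfin) (g.toQuadruple hfin) :=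
  ⟨_, _, rfl, rfl, Or.inl (by simp [toOrderedQuadruple, hv, hw]),
    Or.inl (by simp [toOrderedQuadruple, hv', hw'])⟩

end Frame

theorem Chain.append {F A : Type*} [Field F] [Ring A] [Algebra F A] {m n m' n' : ℕ}
    {p p' p'' : Quadruple F A} (h : Chain m n p p') (h' : Chain m' n' p' p'') :
    Chain (m + m') (n + n') p p'' := by
  induction h' with
  | nil => exact h
  | stepPi _ hs ih => exact (ih h).stepPi hs
  | stepLambdaTwo _ hs ih => exact (ih h).stepLambdaTwo hs

/-! ### Orthogonal complements of hyperbolic pairs -/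

namespace AlbertSpace

variable {F A V : Type*} [Field F] [DivisionRing A] [Algebra F A] [AddCommGroup V] [Module F V]
  (S : AlbertSpace F A V)

/-- The vectors `v, w` are orthogonal to `v', w'`. -/
structure Perp (v w v' w' : V) : Prop where
  vv : S.form v v' = 0
  vw : S.form v w' = 0
  wv : S.form w v' = 0
  ww : S.form w w' = 0

variable {S}

theorem Perp.symm {v w v' w' : V} (h : S.Perp v w v' w') : S.Perp v' w' v w :=
  ⟨by rw [S.form_comm, h.vv], by rw [S.form_comm, h.wv], by rw [S.form_comm, h.vw],
    by rw [S.form_comm, h.ww]⟩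

variable (S)

/-- The component of `t` orthogonal to the hyperbolic pair `v, w`. -/
def proj (v w t : V) : V := t + S.form t w • v + S.form t v • w

theorem form_proj_of_orthogonal {v w s : V} (hv : S.form s v = 0) (hw : S.form s w = 0) (t : V) :
    S.form s (S.proj v w t) = S.form s t := by
  simp only [proj, map_add, map_smul, smul_eq_mul, hv, hw, mul_zero, add_zero]

variable [CharP F 2] [CharP A 2]

theorem form_proj {v w : V} (h : S.form v w = 1) (t : V) :
    S.form v (S.proj v w t) = 0 ∧ S.form w (S.proj v w t) = 0 := by
  simp only [proj, map_add, map_smul, smul_eq_mul, S.form_self, S.form_comm w v, h,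
    S.form_comm v t, S.form_comm w t, mul_zero, mul_one, add_zero]
  exact ⟨CharTwo.add_self_eq_zero _, CharTwo.add_self_eq_zero _⟩

theorem form_proj_proj {v w : V} (h : S.form v w = 1) (s t : V) :
    S.form (S.proj v w s) (S.proj v w t) =
      S.form s t + (S.form v s * S.form w t + S.form v t * S.form w s) := by
  rw [S.form_proj_of_orthogonal (by rw [S.form_comm, (S.form_proj h s).1])
    (by rw [S.form_comm, (S.form_proj h s).2])]
  simp only [proj, map_add, map_smul, smul_eq_mul, LinearMap.add_apply, LinearMap.smul_apply,
    S.form_comm s w, S.form_comm s v]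
  ring

theorem exists_form_ne_zero {v w n : V} (h : S.form v w = 1) (hn : n ≠ 0) (hv : S.form n v = 0)
    (hw : S.form n w = 0) : ∃ m, S.form v m = 0 ∧ S.form w m = 0 ∧ S.form n m ≠ 0 := by
  by_contra hcon
  refine hn (S.nondegenerate n fun t => ?_)
  by_contra ht
  refine hcon ⟨S.proj v w t, (S.form_proj h t).1, (S.form_proj h t).2, ?_⟩
  rwa [S.form_proj_of_orthogonal hv hw]

/-- A vector space is not the union of two proper subspaces: one of a, b, a + b avoids both
hyperplanes. -/
theorem exists_form_ne_zero_both {v w n n' : V} (h : S.form v w = 1) (hn : n ≠ 0)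
    (hv : S.form n v = 0) (hw : S.form n w = 0) (hn' : n' ≠ 0) (hv' : S.form n' v = 0)
    (hw' : S.form n' w = 0) :
    ∃ m, S.form v m = 0 ∧ S.form w m = 0 ∧ S.form n m ≠ 0 ∧ S.form n' m ≠ 0 := by
  obtain ⟨a, ha1, ha2, ha3⟩ := S.exists_form_ne_zero h hn hv hw
  obtain ⟨b, hb1, hb2, hb3⟩ := S.exists_form_ne_zero h hn' hv' hw'
  by_cases h1 : S.form n' a = 0
  · by_cases h2 : S.form n b = 0
    · exact ⟨a + b, by simp [ha1, hb1], by simp [ha2, hb2], by simpa [h2] using ha3,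
        by simpa [h1] using hb3⟩
    · exact ⟨b, hb1, hb2, h2, hb3⟩
  · exact ⟨a, ha1, ha2, ha3, h1⟩

/-- Four linear conditions on a six-dimensional space leave a nonzero n. A partner m chosen
orthogonal to v, w is projected off v', w'; this keeps its pairing with n. -/
theorem exists_third_pair {v w v' w' : V} (h : S.form v w = 1) (h' : S.form v' w' = 1)
    (hp : S.Perp v w v' w') :
    ∃ a c, S.form a c = 1 ∧ S.Perp v w a c ∧ S.Perp v' w' a c := by
  let L : V →ₗ[F] Fin 4 → F := LinearMap.pi ![S.form v, S.form w, S.form v', S.form w']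
  have : FiniteDimensional F V := FiniteDimensional.of_finrank_pos (by rw [S.finrank_eq]; norm_num)
  obtain ⟨n, hn, hn0⟩ := (Submodule.ne_bot_iff _).1
    (LinearMap.ker_ne_bot_of_finrank_lt (f := L) (by rw [S.finrank_eq]; simp))
  have hL := LinearMap.mem_ker.1 hn
  have h0 : S.form v n = 0 := congrFun hL 0
  have h1 : S.form w n = 0 := congrFun hL 1
  have h2 : S.form v' n = 0 := congrFun hL 2
  have h3 : S.form w' n = 0 := congrFun hL 3
  obtain ⟨m, hm1, hm2, hm3⟩ := S.exists_form_ne_zero h hn0 (by rw [S.form_comm, h0])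
    (by rw [S.form_comm, h1])
  have e1 := S.form_proj_of_orthogonal hp.vv hp.vw m
  have e2 := S.form_proj_of_orthogonal hp.wv hp.ww m
  have e3 := S.form_proj_of_orthogonal (s := n) (by rw [S.form_comm, h2])
    (by rw [S.form_comm, h3]) m
  obtain ⟨e4, e5⟩ := S.form_proj h' m
  refine ⟨n, (S.form n m)⁻¹ • S.proj v' w' m, ?_, ⟨h0, ?_, h1, ?_⟩, ⟨h2, ?_, h3, ?_⟩⟩
  · rw [map_smul, e3, smul_eq_mul, inv_mul_cancel₀ hm3]
  · rw [map_smul, e1, hm1, smul_zero]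
  · rw [map_smul, e2, hm2, smul_zero]
  · rw [map_smul, e4, smul_zero]
  · rw [map_smul, e5, smul_zero]

theorem exists_pair_perp {v w n m : V} (h : S.form v w = 1) (hnm : S.form n m ≠ 0)
    (hp : S.Perp v w n m) :
    ∃ a c, S.form a c = 1 ∧ S.Perp v w a c ∧ S.Perp n m a c := by
  obtain ⟨a, c, hac, h1, h2⟩ := S.exists_third_pair (v' := n) (w' := (S.form n m)⁻¹ • m) h
    (by rw [map_smul, smul_eq_mul, inv_mul_cancel₀ hnm])
    ⟨hp.vv, by rw [map_smul, hp.vw, smul_zero], hp.wv, by rw [map_smul, hp.ww, smul_zero]⟩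
  refine ⟨a, c, hac, h1, h2.vv, h2.vw, ?_, ?_⟩
  · simpa [hnm] using h2.wv
  · simpa [hnm] using h2.ww

variable {S}

/-- The frame given by two orthogonal hyperbolic pairs and a vector. -/
def frame {v w a c n : V} (h : S.form v w = 1) (h' : S.form a c = 1) (hp : S.Perp v w a c)
    (h1 : S.form v n = 0) (h2 : S.form w n = 0) (h3 : S.form a n = 0) (h4 : S.form c n = 0)
    (hn : n ≠ 0) : Frame S :=
  ⟨v, w, a, c, n, h, h', hp.vv, hp.vw, hp.wv, hp.ww, h1, h2, h3, h4, hn⟩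

end AlbertSpace

/-! ### Chains between frames -/

namespace Frame

variable {F A V : Type*} [Field F] [DivisionRing A] [Algebra F A] [AddCommGroup V] [Module F V]
  {S : AlbertSpace F A V}

theorem perp (f : Frame S) : S.Perp f.v₁ f.w₁ f.v₂ f.w₂ := ⟨f.v₁v₂, f.v₁w₂, f.w₁v₂, f.w₁w₂⟩

variable [CharP F 2] [CharP A 2]

/-- If `m` is orthogonal to the two pairs of `g` and not to the vector of `f`, and `f` and `g` share
the first pair, then the second pair can be replaced and the vector changed to `m`. -/
theorem chain_of_form_ne_zero (hfin : Module.finrank F A = 16) {f g : Frame S} (hv : f.v₁ = g.v₁)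
    (hw : f.w₁ = g.w₁) (hm : S.form f.n g.n ≠ 0) :
    Chain 2 1 (f.toQuadruple hfin) (g.toQuadruple hfin) := by
  have hvm : S.form f.v₁ g.n = 0 := hv ▸ g.v₁n
  have hwm : S.form f.w₁ g.n = 0 := hw ▸ g.w₁n
  -- The vectors of f and g span a nondegenerate plane orthogonal to the first pair; a second pair
  -- orthogonal to that plane tolerates both vectors.
  obtain ⟨a, c, hac, hp, hq⟩ := S.exists_pair_perp f.v₁w₁ hm ⟨f.v₁n, hvm, f.w₁n, hwm⟩
  let h₁ : Frame S := AlbertSpace.frame f.v₁w₁ hac hp f.v₁n f.w₁n hq.symm.vv hq.symm.wv f.n_ne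
  let h₂ : Frame S := AlbertSpace.frame f.v₁w₁ hac hp hvm hwm hq.symm.vw hq.symm.ww g.n_ne
  have s₁ : StepPi (f.toQuadruple hfin) (h₁.toQuadruple hfin) := stepPi_of_first_eq hfin rfl rfl rfl
  have s₂ : StepLambdaTwo (h₁.toQuadruple hfin) (h₂.toQuadruple hfin) :=
    stepLambdaTwo_of_eq hfin rfl rfl rfl rfl
  have s₃ : StepPi (h₂.toQuadruple hfin) (g.toQuadruple hfin) := stepPi_of_first_eq hfin hv hw rfl
  exact (((Chain.nil _).stepPi s₁).stepLambdaTwo s₂).stepPi s₃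

/-- When the two vectors may be orthogonal, the passage goes through an m orthogonal to neither. The
intermediate second pair is chosen orthogonal to m and to the vector of g, so changing m into that
vector needs no further change of pair. -/
theorem chain_of_first_eq (hfin : Module.finrank F A = 16) {f g : Frame S} (hv : f.v₁ = g.v₁)
    (hw : f.w₁ = g.w₁) : Chain 3 2 (f.toQuadruple hfin) (g.toQuadruple hfin) := by
  obtain ⟨m, hvm, hwm, hm, hm'⟩ := S.exists_form_ne_zero_both f.v₁w₁ f.n_ne
    (by rw [S.form_comm, f.v₁n]) (by rw [S.form_comm, f.w₁n]) g.n_ne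
    (by rw [S.form_comm, hv, g.v₁n]) (by rw [S.form_comm, hw, g.w₁n])
  have hm0 : m ≠ 0 := by rintro rfl; simp at hm
  have hvg : S.form f.v₁ g.n = 0 := hv ▸ g.v₁n
  have hwg : S.form f.w₁ g.n = 0 := hw ▸ g.w₁n
  obtain ⟨a, c, hac, hp, hq⟩ := S.exists_pair_perp f.v₁w₁ hm' ⟨hvg, hvm, hwg, hwm⟩
  let h₁ : Frame S := AlbertSpace.frame f.v₁w₁ hac hp hvm hwm hq.symm.vw hq.symm.ww hm0
  let h₂ : Frame S := AlbertSpace.frame f.v₁w₁ hac hp hvg hwg hq.symm.vv hq.symm.wv g.n_ne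
  have s₁ : Chain 2 1 (f.toQuadruple hfin) (h₁.toQuadruple hfin) :=
    chain_of_form_ne_zero hfin rfl rfl hm
  have s₂ : StepLambdaTwo (h₁.toQuadruple hfin) (h₂.toQuadruple hfin) :=
    stepLambdaTwo_of_eq hfin rfl rfl rfl rfl
  have s₃ : StepPi (h₂.toQuadruple hfin) (g.toQuadruple hfin) := stepPi_of_first_eq hfin hv hw rfl
  exact (s₁.stepLambdaTwo s₂).stepPi s₃

/-- The projections of a, c off v, w pair to 1 plus the determinant, here nonzero. So v, w, a, c
span a nondegenerate 4-space, and its complement is the desired plane. -/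
theorem exists_pair_perp_of_det_ne {v w a c : V} (h : S.form v w = 1) (h' : S.form a c = 1)
    (hdet : S.form v a * S.form w c + S.form v c * S.form w a ≠ 1) :
    ∃ b d, S.form b d = 1 ∧ S.Perp v w b d ∧ S.Perp a c b d ∧
      S.Perp (S.proj v w a) (S.proj v w c) b d := by
  have hne : S.form (S.proj v w a) (S.proj v w c) ≠ 0 := by
    rw [S.form_proj_proj h, h']
    intro h0
    exact hdet (by rw [← CharTwo.add_eq_zero, add_comm]; exact h0)
  obtain ⟨b, d, hbd, hp, hq⟩ := S.exists_pair_perp h hne ⟨(S.form_proj h a).1, (S.form_proj h c).1,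
    (S.form_proj h a).2, (S.form_proj h c).2⟩
  have key : ∀ t s, S.form v s = 0 → S.form w s = 0 → S.form (S.proj v w t) s = 0 →
      S.form t s = 0 := by
    intro t s h1 h2 h3
    rwa [S.form_comm, S.form_proj_of_orthogonal (by rw [S.form_comm, h1])
      (by rw [S.form_comm, h2]), S.form_comm] at h3
  exact ⟨b, d, hbd, hp, ⟨key _ _ hp.vv hp.wv hq.vv, key _ _ hp.vw hp.ww hq.vw,
    key _ _ hp.vv hp.wv hq.wv, key _ _ hp.vw hp.ww hq.ww⟩, hq⟩

/-- If the second pair of a frame can be moved, by replacing its vector `n` and shearing its first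
pair along the new vector, into a position where the first pair and `a, c` span a nondegenerate
space, then it can be made orthogonal to `a, c`. -/
theorem exists_chain_perp_of_shear (hfin : Module.finrank F A = 16) (f : Frame S) {a c : V}
    (hac : S.form a c = 1) {n : V} (h1 : S.form f.v₁ n = 0) (h2 : S.form f.w₁ n = 0)
    (h3 : S.form f.v₂ n = 0) (h4 : S.form f.w₂ n = 0)
    (hn : S.form n a ≠ 0 ∨ S.form n c ≠ 0) (s t : F)
    (hdet : S.form (f.v₁ + s • n) a * S.form (f.w₁ + t • n) c +
      S.form (f.v₁ + s • n) c * S.form (f.w₁ + t • n) a ≠ 1) :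
    ∃ g : Frame S, S.Perp a c g.v₂ g.w₂ ∧ Chain 3 2 (f.toQuadruple hfin) (g.toQuadruple hfin) := by
  have hn0 : n ≠ 0 := by rintro rfl; simp at hn
  have hvw : S.form (f.v₁ + s • n) (f.w₁ + t • n) = 1 := by
    simp [f.v₁w₁, h1, S.form_comm n, h2, S.form_self]
  have hvn : S.form (f.v₁ + s • n) n = 0 := by simp [h1, S.form_self]
  have hwn : S.form (f.w₁ + t • n) n = 0 := by simp [h2, S.form_self]
  have hp : S.Perp (f.v₁ + s • n) (f.w₁ + t • n) f.v₂ f.w₂ :=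
    ⟨by simp [f.v₁v₂, S.form_comm n, h3], by simp [f.v₁w₂, S.form_comm n, h4],
      by simp [f.w₁v₂, S.form_comm n, h3], by simp [f.w₁w₂, S.form_comm n, h4]⟩
  obtain ⟨b, d, hbd, hp1, hp2, hp3⟩ := exists_pair_perp_of_det_ne hvw hac hdet
  let h₁ : Frame S := AlbertSpace.frame f.v₁w₁ f.v₂w₂ f.perp h1 h2 h3 h4 hn0
  let h₂ : Frame S := AlbertSpace.frame hvw f.v₂w₂ hp hvn hwn h3 h4 hn0
  have s₁ : StepLambdaTwo (f.toQuadruple hfin) (h₁.toQuadruple hfin) :=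
    stepLambdaTwo_of_eq hfin rfl rfl rfl rfl
  have s₂ : StepPi (h₁.toQuadruple hfin) (h₂.toQuadruple hfin) :=
    stepPi_of_second_eq hfin rfl rfl rfl
  -- The next vector is the projection of a or c, whichever is not orthogonal to n: it is orthogonal
  -- to the sheared first pair and to b, d, and it pairs nontrivially with n.
  have last : ∀ e, S.form n e ≠ 0 → S.form (S.proj (f.v₁ + s • n) (f.w₁ + t • n) e) b = 0 →
      S.form (S.proj (f.v₁ + s • n) (f.w₁ + t • n) e) d = 0 →
      ∃ g : Frame S, S.Perp a c g.v₂ g.w₂ ∧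
        Chain 3 2 (f.toQuadruple hfin) (g.toQuadruple hfin) := by
    intro e he heb hed
    have hm : S.form n (S.proj (f.v₁ + s • n) (f.w₁ + t • n) e) ≠ 0 := by
      rwa [S.form_proj_of_orthogonal (by rw [S.form_comm, hvn]) (by rw [S.form_comm, hwn])]
    have hm0 : S.proj (f.v₁ + s • n) (f.w₁ + t • n) e ≠ 0 := by
      intro h0; rw [h0, map_zero] at hm; exact hm rfl
    let g : Frame S := AlbertSpace.frame hvw hbd hp1 (S.form_proj hvw e).1 (S.form_proj hvw e).2
      (by rw [S.form_comm, heb]) (by rw [S.form_comm, hed]) hm0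
    have s₃ : Chain 2 1 (h₂.toQuadruple hfin) (g.toQuadruple hfin) :=
      chain_of_form_ne_zero hfin rfl rfl hm
    exact ⟨g, hp2, (((Chain.nil _).stepLambdaTwo s₁).stepPi s₂).append s₃⟩
  rcases hn with hn | hn
  · exact last a hn hp3.vv hp3.vw
  · exact last c hn hp3.wv hp3.ww

/-- If some hyperbolic pair is orthogonal both to the first pair and to a, c, it can serve as the
second pair directly. Otherwise the determinant equals 1, and a shear of the first pair is used to
change it. -/
theorem exists_chain_perp (hfin : Module.finrank F A = 16) (f : Frame S) {a c : V}
    (hac : S.form a c = 1) :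
    ∃ g : Frame S, S.Perp a c g.v₂ g.w₂ ∧ Chain 3 2 (f.toQuadruple hfin) (g.toQuadruple hfin) := by
  by_cases hex : ∃ b d, S.form b d = 1 ∧ S.Perp f.v₁ f.w₁ b d ∧ S.Perp a c b d
  · obtain ⟨b, d, hbd, hp, hp'⟩ := hex
    obtain ⟨k, l, hkl, hk1, hk2⟩ := S.exists_third_pair f.v₁w₁ hbd hp
    have hk0 : k ≠ 0 := by rintro rfl; simp at hkl
    exact ⟨AlbertSpace.frame f.v₁w₁ hbd hp hk1.vv hk1.wv hk2.vv hk2.wv hk0, hp',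
      chain_of_first_eq hfin rfl rfl⟩
  have hdet : S.form f.v₁ a * S.form f.w₁ c + S.form f.v₁ c * S.form f.w₁ a = 1 := by
    by_contra h
    obtain ⟨b, d, h1, h2, h3, -⟩ := exists_pair_perp_of_det_ne f.v₁w₁ hac h
    exact hex ⟨b, d, h1, h2, h3⟩
  -- If the third plane of the frame were orthogonal to a and c, it would itself provide the
  -- excluded pair.
  have hn : ∃ n, S.form f.v₁ n = 0 ∧ S.form f.w₁ n = 0 ∧ S.form f.v₂ n = 0 ∧ S.form f.w₂ n = 0 ∧
      (S.form n a ≠ 0 ∨ S.form n c ≠ 0) := by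
    obtain ⟨k, l, hkl, hk1, hk2⟩ := S.exists_third_pair f.v₁w₁ f.v₂w₂ f.perp
    by_contra hcon
    have h1 : S.form k a = 0 ∧ S.form k c = 0 := by
      by_contra h
      exact hcon ⟨k, hk1.vv, hk1.wv, hk2.vv, hk2.wv, by tauto⟩
    have h2 : S.form l a = 0 ∧ S.form l c = 0 := by
      by_contra h
      exact hcon ⟨l, hk1.vw, hk1.ww, hk2.vw, hk2.ww, by tauto⟩
    exact hex ⟨k, l, hkl, hk1, AlbertSpace.Perp.symm ⟨h1.1, h1.2, h2.1, h2.2⟩⟩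
  obtain ⟨n, h1, h2, h3, h4, hn⟩ := hn
  by_cases hs : S.form n a * S.form f.w₁ c + S.form n c * S.form f.w₁ a = 0
  · refine f.exists_chain_perp_of_shear hfin hac h1 h2 h3 h4 hn 0 1 ?_
    simp only [map_add, map_smul, LinearMap.add_apply, LinearMap.smul_apply, smul_eq_mul]
    intro h
    have ht : S.form f.v₁ a * S.form n c + S.form f.v₁ c * S.form n a = 0 := by
      linear_combination h - hdet
    -- Cramer's rule: if shearing neither v₁ nor w₁ alters the determinant, then `hs` and `ht` form
    -- a linear system of determinant 1 for the pairings of n with a and c, so both vanish.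
    have two : (2 : F) = 0 := CharTwo.two_eq_zero
    have ha : S.form n a = 0 := by
      linear_combination S.form n a * (-hdet) + S.form f.v₁ a * hs + S.form f.w₁ a * ht
        - (S.form f.w₁ a * S.form f.v₁ a * S.form n c) * two
    have hc : S.form n c = 0 := by
      linear_combination S.form n c * (-hdet) + S.form f.v₁ c * hs + S.form f.w₁ c * ht
        - (S.form f.w₁ c * S.form f.v₁ c * S.form n a) * two
    exact hn.elim (fun h => h ha) (fun h => h hc)
  · refine f.exists_chain_perp_of_shear hfin hac h1 h2 h3 h4 hn 1 0 ?_
    simp only [map_add, map_smul, LinearMap.add_apply, LinearMap.smul_apply, smul_eq_mul]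
    intro h
    exact hs (by linear_combination h - hdet)

/-- The intermediate frame e joins the first pair of g to the second pair of h, which is possible
once these are orthogonal. -/
theorem chain_nine_six (hfin : Module.finrank F A = 16) (f g : Frame S) :
    Chain 9 6 (f.toQuadruple hfin) (g.toQuadruple hfin) := by
  obtain ⟨h, hp, hc⟩ := f.exists_chain_perp hfin g.v₁w₁
  obtain ⟨k, l, hkl, hk1, hk2⟩ := S.exists_third_pair g.v₁w₁ h.v₂w₂ hp
  have hk0 : k ≠ 0 := by rintro rfl; simp at hkl
  let e : Frame S := AlbertSpace.frame g.v₁w₁ h.v₂w₂ hp hk1.vv hk1.wv hk2.vv hk2.wv hk0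
  have h₁ : Chain 3 2 (h.toQuadruple hfin) (e.toQuadruple hfin) := by
    rw [← toQuadruple_swap hfin h, ← toQuadruple_swap hfin e]
    exact chain_of_first_eq hfin rfl rfl
  have h₂ : Chain 3 2 (e.toQuadruple hfin) (g.toQuadruple hfin) :=
    chain_of_first_eq hfin rfl rfl
  exact (hc.append h₁).append h₂

end Frame

/-! ### The Albert form in coordinates -/

section Construction

variable {F : Type*} [Field F] (α β γ δ : F)

/-- The first component of a vector of the Albert space of `[α, β) ⊗ [γ, δ)`. -/
def albertLeft : (Fin 6 → F) →ₗ[F] ℍ[F, α, 1, β] where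
  toFun c := ⟨c 0, c 5, c 1, c 2⟩
  map_add' _ _ := rfl
  map_smul' _ _ := rfl

/-- The conjugate of `albertLeft`. -/
def albertLeftStar : (Fin 6 → F) →ₗ[F] ℍ[F, α, 1, β] where
  toFun c := ⟨c 0 + c 5, c 5, c 1, c 2⟩
  map_add' c d := by ext <;> simp; ring
  map_smul' r c := by ext <;> simp; ring

/-- The second component of a vector of the Albert space of `[α, β) ⊗ [γ, δ)`. -/
def albertRight : (Fin 6 → F) →ₗ[F] ℍ[F, γ, 1, δ] where
  toFun c := ⟨0, c 5, c 3, c 4⟩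
  map_add' c d := by ext <;> simp
  map_smul' r c := by ext <;> simp

/-- The polar form of the Albert form. -/
def albertForm : (Fin 6 → F) →ₗ[F] (Fin 6 → F) →ₗ[F] F :=
  LinearMap.mk₂ F (fun c d => c 0 * d 5 + c 5 * d 0 + β * (c 1 * d 2 + c 2 * d 1) +
      δ * (c 3 * d 4 + c 4 * d 3))
    (fun c c' d => by simp; ring) (fun r c d => by simp; ring)
    (fun c d d' => by simp; ring) (fun r c d => by simp; ring)

/-- The Albert form. -/
def albertQuad (c : Fin 6 → F) : F :=
  c 0 ^ 2 + c 0 * c 5 + α * c 5 ^ 2 + β * (c 1 ^ 2 + c 1 * c 2 + α * c 2 ^ 2) +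
    (γ * c 5 ^ 2 + δ * (c 3 ^ 2 + c 3 * c 4 + γ * c 4 ^ 2))

theorem albertForm_nondegenerate {β δ : F} (hβ : β ≠ 0) (hδ : δ ≠ 0) (v : Fin 6 → F)
    (h : ∀ w, albertForm β δ v w = 0) : v = 0 := by
  have h0 := h (Pi.single 0 1)
  have h1 := h (Pi.single 1 1)
  have h2 := h (Pi.single 2 1)
  have h3 := h (Pi.single 3 1)
  have h4 := h (Pi.single 4 1)
  have h5 := h (Pi.single 5 1)
  simp [albertForm, hβ, hδ] at h0 h1 h2 h3 h4 h5
  funext k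
  fin_cases k <;> assumption

variable [CharP F 2]

theorem albertLeft_mul_star_add (v w : Fin 6 → F) :
    albertLeft α β v * albertLeftStar α β w + albertLeft α β w * albertLeftStar α β v =
      algebraMap F _ (v 0 * w 5 + v 5 * w 0 + β * (v 1 * w 2 + v 2 * w 1)) := by
  rw [QuaternionAlgebra.algebraMap_eq]
  ext <;> simp [albertLeft, albertLeftStar] <;> grind

theorem albertLeftStar_mul_add (v w : Fin 6 → F) :
    albertLeftStar α β v * albertLeft α β w + albertLeftStar α β w * albertLeft α β v =
      algebraMap F _ (v 0 * w 5 + v 5 * w 0 + β * (v 1 * w 2 + v 2 * w 1)) := by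
  rw [QuaternionAlgebra.algebraMap_eq]
  ext <;> simp [albertLeft, albertLeftStar] <;> grind

theorem albertRight_mul_add (v w : Fin 6 → F) :
    albertRight γ δ v * albertRight γ δ w + albertRight γ δ w * albertRight γ δ v =
      algebraMap F _ (δ * (v 3 * w 4 + v 4 * w 3)) + (algebraMap F _ (v 5) * albertRight γ δ w +
        algebraMap F _ (w 5) * albertRight γ δ v) := by
  simp only [QuaternionAlgebra.algebraMap_eq]
  ext <;> simp [albertRight] <;> grind

theorem albertLeft_mul_star (v : Fin 6 → F) :
    albertLeft α β v * albertLeftStar α β v = algebraMap F _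
      (v 0 ^ 2 + v 0 * v 5 + α * v 5 ^ 2 + β * (v 1 ^ 2 + v 1 * v 2 + α * v 2 ^ 2)) := by
  rw [QuaternionAlgebra.algebraMap_eq]
  ext <;> simp [albertLeft, albertLeftStar] <;> grind

theorem albertLeftStar_mul (v : Fin 6 → F) :
    albertLeftStar α β v * albertLeft α β v = algebraMap F _
      (v 0 ^ 2 + v 0 * v 5 + α * v 5 ^ 2 + β * (v 1 ^ 2 + v 1 * v 2 + α * v 2 ^ 2)) := by
  rw [QuaternionAlgebra.algebraMap_eq]
  ext <;> simp [albertLeft, albertLeftStar] <;> grind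

theorem albertRight_mul_self (v : Fin 6 → F) :
    albertRight γ δ v * albertRight γ δ v = algebraMap F _
      (γ * v 5 ^ 2 + δ * (v 3 ^ 2 + v 3 * v 4 + γ * v 4 ^ 2)) +
        algebraMap F _ (v 5) * albertRight γ δ v := by
  simp only [QuaternionAlgebra.algebraMap_eq]
  ext <;> simp [albertRight] <;> grind

theorem albertLeft_add_star (v : Fin 6 → F) :
    albertLeft α β v + albertLeftStar α β v = algebraMap F _ (v 5) := by
  rw [QuaternionAlgebra.algebraMap_eq]
  ext <;> simp [albertLeft, albertLeftStar] <;> grind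

theorem star_eq_add (a : ℍ[F, α, 1, β]) : star a = a + algebraMap F _ a.imI := by
  rw [QuaternionAlgebra.algebraMap_eq]
  ext <;> simp [CharTwo.neg_eq]

end Construction

/-! ### The Albert space of two commuting quaternion algebras -/

section Components

variable {F A : Type*} [Field F] [DivisionRing A] [Algebra F A] {α β γ δ : F}
  (φ : ℍ[F, α, 1, β] →ₐ[F] A) (ψ : ℍ[F, γ, 1, δ] →ₐ[F] A)

theorem add_mul_add_add_of_commute [CharP A 2] {a a' b b' c₁ c₂ d e s t : A}
    (h₁ : a * b' + b * a' = c₁) (h₂ : d * e + e * d = c₂ + (t * e + s * d)) (h₃ : a + a' = t)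
    (h₄ : b + b' = s) (ha' : a' * e = e * a') (hb' : b' * d = d * b') :
    (a + d) * (b' + e) + (b + e) * (a' + d) = c₁ + c₂ := by
  calc (a + d) * (b' + e) + (b + e) * (a' + d)
      = (a * b' + b * a') + (d * e + e * d) + ((a + a') * e + (b + b') * d) := by
        simp only [mul_add, add_mul, ha', hb']; abel
    _ = c₁ + c₂ + ((t * e + s * d) + (t * e + s * d)) := by
        rw [h₁, h₂, h₃, h₄]; abel
    _ = c₁ + c₂ := by rw [CharTwo.add_self_eq_zero, add_zero]

/-- With a' the conjugate of a and d of the same trace t as a, the cross term td cancels against the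
one in d². What remains is the sum of the two norms; the preceding lemma is the polarized form. -/
theorem add_mul_add_of_commute [CharP A 2] {a a' c₁ c₂ d t : A}
    (h₁ : a * a' = c₁) (h₂ : d * d = c₂ + t * d) (h₃ : a + a' = t) (ha' : a' * d = d * a') :
    (a + d) * (a' + d) = c₁ + c₂ := by
  calc (a + d) * (a' + d) = a * a' + d * d + (a + a') * d := by
        simp only [mul_add, add_mul, ha']; abel
    _ = c₁ + c₂ + (t * d + t * d) := by rw [h₁, h₂, h₃]; abel
    _ = c₁ + c₂ := by rw [CharTwo.add_self_eq_zero, add_zero]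

/-- The embedding of the Albert space. -/
def albertI : (Fin 6 → F) →ₗ[F] A :=
  φ.toLinearMap ∘ₗ albertLeft α β + ψ.toLinearMap ∘ₗ albertRight γ δ

/-- The conjugate embedding of the Albert space. -/
def albertP : (Fin 6 → F) →ₗ[F] A :=
  φ.toLinearMap ∘ₗ albertLeftStar α β + ψ.toLinearMap ∘ₗ albertRight γ δ

theorem albertI_apply (v : Fin 6 → F) :
    albertI φ ψ v = φ (albertLeft α β v) + ψ (albertRight γ δ v) := rfl

theorem albertP_apply (v : Fin 6 → F) :
    albertP φ ψ v = φ (albertLeftStar α β v) + ψ (albertRight γ δ v) := rfl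

/-- The Albert space of a division algebra generated by two commuting quaternion algebras. -/
def albertSpace [CharP F 2] [CharP A 2] (hβ : β ≠ 0) (hδ : δ ≠ 0)
    (hcomm : ∀ a b, φ a * ψ b = ψ b * φ a)
    (hI : Function.Injective (albertI φ ψ)) (hP : Function.Injective (albertP φ ψ)) :
    AlbertSpace F A (Fin 6 → F) where
  i := albertI φ ψ
  p := albertP φ ψ
  form := albertForm β δ
  quad := albertQuad α β γ δ
  i_mul_p_add v w := by
    have h1 := congrArg φ (albertLeft_mul_star_add α β v w)
    have h2 := congrArg ψ (albertRight_mul_add γ δ v w)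
    have h3 := congrArg φ (albertLeft_add_star α β v)
    have h4 := congrArg φ (albertLeft_add_star α β w)
    simp only [map_add φ, map_mul φ, map_add ψ, map_mul ψ, AlgHom.commutes] at h1 h2 h3 h4
    rw [albertI_apply, albertP_apply, albertI_apply, albertP_apply,
      add_mul_add_add_of_commute h1 h2 h3 h4 (hcomm _ _) (hcomm _ _), ← map_add]
    rfl
  p_mul_i_add v w := by
    have h1 := congrArg φ (albertLeftStar_mul_add α β v w)
    have h2 := congrArg ψ (albertRight_mul_add γ δ v w)
    have h3 := congrArg φ ((add_comm _ _).trans (albertLeft_add_star α β v))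
    have h4 := congrArg φ ((add_comm _ _).trans (albertLeft_add_star α β w))
    simp only [map_add φ, map_mul φ, map_add ψ, map_mul ψ, AlgHom.commutes] at h1 h2 h3 h4
    rw [albertI_apply, albertP_apply, albertI_apply, albertP_apply,
      add_mul_add_add_of_commute h1 h2 h3 h4 (hcomm _ _) (hcomm _ _), ← map_add]
    rfl
  i_mul_p v := by
    have h1 := congrArg φ (albertLeft_mul_star α β v)
    have h2 := congrArg ψ (albertRight_mul_self γ δ v)
    have h3 := congrArg φ (albertLeft_add_star α β v)
    simp only [map_add φ, map_mul φ, map_add ψ, map_mul ψ, AlgHom.commutes] at h1 h2 h3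
    rw [albertI_apply, albertP_apply, add_mul_add_of_commute h1 h2 h3 (hcomm _ _), ← map_add]
    rfl
  p_mul_i v := by
    have h1 := congrArg φ (albertLeftStar_mul α β v)
    have h2 := congrArg ψ (albertRight_mul_self γ δ v)
    have h3 := congrArg φ ((add_comm _ _).trans (albertLeft_add_star α β v))
    simp only [map_add φ, map_mul φ, map_add ψ, map_mul ψ, AlgHom.commutes] at h1 h2 h3
    rw [albertI_apply, albertP_apply, add_mul_add_of_commute h1 h2 h3 (hcomm _ _), ← map_add]
    rfl
  i_injective := hI
  p_injective := hP
  nondegenerate := albertForm_nondegenerate hβ hδ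
  finrank_eq := by simp

theorem exists_albertI_eq_add_star [CharP F 2]
    (a : ℍ[F, α, 1, β]) (b : ℍ[F, γ, 1, δ]) :
    ∃ v, albertI φ ψ v = φ a * ψ b + φ (star a) * ψ (star b) := by
  have : CharP A 2 := charP_of_injective_algebraMap (algebraMap F A).injective 2
  -- The traces of a, b are `a.imI`, `b.imI`, so the right side is tr(b)a + tr(a)b + tr(a)tr(b), a
  -- sum of elements of equal trace. The scalar part of tr(a)b is moved to the first summand.
  refine ⟨![b.imI * a.re + a.imI * b.re + a.imI * b.imI, b.imI * a.imJ, b.imI * a.imK,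
    a.imI * b.imJ, a.imI * b.imK, a.imI * b.imI], ?_⟩
  set v : Fin 6 → F := ![b.imI * a.re + a.imI * b.re + a.imI * b.imI, b.imI * a.imJ,
    b.imI * a.imK, a.imI * b.imJ, a.imI * b.imK, a.imI * b.imI] with hv
  have hl : albertLeft α β v = b.imI • a + algebraMap F _ (a.imI * b.re + a.imI * b.imI) := by
    rw [QuaternionAlgebra.algebraMap_eq]
    ext <;> simp [albertLeft, hv] <;> ring
  have hr : albertRight γ δ v = a.imI • b + algebraMap F _ (a.imI * b.re) := by
    rw [QuaternionAlgebra.algebraMap_eq]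
    ext <;> simp [albertRight, hv, CharTwo.add_self_eq_zero]
  rw [albertI_apply, hl, hr, star_eq_add, star_eq_add]
  simp only [map_add, AlgHom.commutes, Algebra.smul_def, map_mul, add_mul, mul_add]
  rw [← Algebra.commutes b.imI (φ a)]
  have e : ∀ p q r s t : A, p + (q + r) + (s + q) = t + (t + s + (p + r)) := by
    intro p q r s t
    calc p + (q + r) + (s + q) = p + r + s + (q + q) := by abel
      _ = p + r + s + (t + t) := by simp only [CharTwo.add_self_eq_zero]
      _ = _ := by abel
  exact e _ _ _ _ _

end Components

/-! ### The tensor involution and existence of the Albert space -/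

section Tensor

variable {F : Type*} [Field F] {α β γ δ : F}

theorem eq_zero_of_tmul_one_add_one_tmul {a : ℍ[F, α, 1, β]} {b : ℍ[F, γ, 1, δ]} (hb : b.re = 0)
    (h : a ⊗ₜ[F] (1 : ℍ[F, γ, 1, δ]) + (1 : ℍ[F, α, 1, β]) ⊗ₜ[F] b = 0) : a = 0 ∧ b = 0 := by
  have key : ∀ k l, (QuaternionAlgebra.basisOneIJK α 1 β).repr a k *
      (QuaternionAlgebra.basisOneIJK γ 1 δ).repr 1 l +
      (QuaternionAlgebra.basisOneIJK α 1 β).repr 1 k *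
      (QuaternionAlgebra.basisOneIJK γ 1 δ).repr b l = 0 := by
    intro k l
    have := congrArg (fun t => ((QuaternionAlgebra.basisOneIJK α 1 β).tensorProduct
      (QuaternionAlgebra.basisOneIJK γ 1 δ)).repr t (k, l)) h
    simpa [Module.Basis.tensorProduct_repr_tmul_apply, mul_comm] using this
  have h00 := key 0 0
  have h10 := key 1 0
  have h20 := key 2 0
  have h30 := key 3 0
  have h01 := key 0 1
  have h02 := key 0 2
  have h03 := key 0 3
  simp [hb] at h00 h10 h20 h30 h01 h02 h03
  exact ⟨by ext <;> simp [*], by ext <;> simp [*]⟩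

variable (α β γ δ)

/-- The tensor product of the canonical involutions. -/
def tensorStar : ℍ[F, α, 1, β] ⊗[F] ℍ[F, γ, 1, δ] ≃ₐ[F] (ℍ[F, α, 1, β] ⊗[F] ℍ[F, γ, 1, δ])ᵐᵒᵖ :=
  (Algebra.TensorProduct.congr QuaternionAlgebra.starAe QuaternionAlgebra.starAe).trans
    (Algebra.TensorProduct.opAlgEquiv F F _ _)

theorem unop_tensorStar_tmul (a : ℍ[F, α, 1, β]) (b : ℍ[F, γ, 1, δ]) :
    MulOpposite.unop (tensorStar α β γ δ (a ⊗ₜ[F] b)) = star a ⊗ₜ[F] star b := by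
  simp [tensorStar]

theorem unop_tensorStar_involutive (t : ℍ[F, α, 1, β] ⊗[F] ℍ[F, γ, 1, δ]) :
    MulOpposite.unop (tensorStar α β γ δ (MulOpposite.unop (tensorStar α β γ δ t))) = t := by
  induction t using TensorProduct.induction_on with
  | zero => simp
  | tmul a b => rw [unop_tensorStar_tmul, unop_tensorStar_tmul, star_star, star_star]
  | add s t hs ht =>
    rw [map_add, MulOpposite.unop_add, map_add, MulOpposite.unop_add, hs, ht]

end Tensor

theorem IsBiquaternionAlgebra.finrank_eq {F A : Type*} [Field F] [Ring A] [Algebra F A]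
    (hA : IsBiquaternionAlgebra F A) : Module.finrank F A = 16 := by
  obtain ⟨α, β, γ, δ, -, -, ⟨e⟩⟩ := hA
  rw [e.toLinearEquiv.finrank_eq, Module.finrank_tensorProduct, QuaternionAlgebra.finrank_eq_four,
    QuaternionAlgebra.finrank_eq_four]

theorem IsBiquaternionAlgebra.exists_albertSpace {F A : Type*} [Field F] [CharP F 2]
    [DivisionRing A] [Algebra F A] (hA : IsBiquaternionAlgebra F A) :
    ∃ (S : AlbertSpace F A (Fin 6 → F)) (σ : A →ₗ[F] A), (∀ a b, σ (a * b) = σ b * σ a) ∧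
      (∀ a, σ (σ a) = a) ∧ ∀ a, ∃ v, S.i v = a + σ a := by
  have : CharP A 2 := charP_of_injective_algebraMap (algebraMap F A).injective 2
  obtain ⟨α, β, γ, δ, hβ, hδ, ⟨e⟩⟩ := hA
  let φ : ℍ[F, α, 1, β] →ₐ[F] A := e.symm.toAlgHom.comp Algebra.TensorProduct.includeLeft
  let ψ : ℍ[F, γ, 1, δ] →ₐ[F] A := e.symm.toAlgHom.comp Algebra.TensorProduct.includeRight
  have hφψ : ∀ a b, φ a * ψ b = e.symm (a ⊗ₜ b) := by
    intro a b
    change e.symm (a ⊗ₜ 1) * e.symm (1 ⊗ₜ b) = _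
    rw [← map_mul, Algebra.TensorProduct.tmul_mul_tmul, mul_one, one_mul]
  have hcomm : ∀ a b, φ a * ψ b = ψ b * φ a := by
    intro a b
    rw [hφψ]
    change _ = e.symm (1 ⊗ₜ b) * e.symm (a ⊗ₜ 1)
    rw [← map_mul, Algebra.TensorProduct.tmul_mul_tmul, mul_one, one_mul]
  have hinj : ∀ a b, b.re = 0 → φ a + ψ b = 0 → a = 0 ∧ b = 0 := by
    intro a b hb h
    refine eq_zero_of_tmul_one_add_one_tmul hb (e.symm.injective ?_)
    rw [map_add, map_zero]
    exact h
  have hI : Function.Injective (albertI φ ψ) := by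
    refine (injective_iff_map_eq_zero _).2 fun v hv => ?_
    obtain ⟨h1, h2⟩ := hinj _ _ rfl hv
    simp [albertLeft, albertRight, QuaternionAlgebra.ext_iff] at h1 h2
    funext k
    fin_cases k <;> simp [*]
  have hP : Function.Injective (albertP φ ψ) := by
    refine (injective_iff_map_eq_zero _).2 fun v hv => ?_
    obtain ⟨h1, h2⟩ := hinj _ _ rfl hv
    simp [albertLeftStar, albertRight, QuaternionAlgebra.ext_iff] at h1 h2
    have h0 : v 0 = 0 := by simpa [h2.1] using h1.1
    funext k
    fin_cases k <;> simp [*]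
  let σ : A →ₗ[F] A := e.symm.toLinearMap ∘ₗ (MulOpposite.opLinearEquiv F).symm.toLinearMap ∘ₗ
    (tensorStar α β γ δ).toLinearMap ∘ₗ e.toLinearMap
  have hσ : ∀ a, σ a = e.symm (MulOpposite.unop (tensorStar α β γ δ (e a))) := fun a => rfl
  refine ⟨albertSpace φ ψ hβ hδ hcomm hI hP, σ, ?_, ?_, ?_⟩
  · intro a b
    rw [hσ, hσ, hσ, map_mul, map_mul, MulOpposite.unop_mul, map_mul]
  · intro a
    rw [hσ, hσ, AlgEquiv.apply_symm_apply, unop_tensorStar_involutive, AlgEquiv.symm_apply_apply]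
  · intro a
    obtain ⟨t, rfl⟩ := e.symm.surjective a
    induction t using TensorProduct.induction_on with
    | zero => exact ⟨0, by simp⟩
    | tmul a b =>
      obtain ⟨v, hv⟩ := exists_albertI_eq_add_star φ ψ a b
      refine ⟨v, hv.trans ?_⟩
      rw [hφψ, hφψ, hσ, AlgEquiv.apply_symm_apply, unop_tensorStar_tmul]
    | add s t hs ht =>
      obtain ⟨v, hv⟩ := hs
      obtain ⟨w, hw⟩ := ht
      refine ⟨v + w, ?_⟩
      rw [map_add, hv, hw, map_add e.symm, map_add σ]
      abel

/-! ### Skolem–Noether by averaging -/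

section Intertwiner

variable {F A : Type*} [Field F] [DivisionRing A] [Algebra F A]

theorem involution_one {σ : A →ₗ[F] A} (hσmul : ∀ a b, σ (a * b) = σ b * σ a)
    (hσσ : ∀ a, σ (σ a) = a) : σ 1 = 1 := by
  have h := hσmul (σ 1) 1
  rw [mul_one, hσσ, mul_one] at h
  exact h.symm

theorem involution_algebraMap {σ : A →ₗ[F] A} (hσmul : ∀ a b, σ (a * b) = σ b * σ a)
    (hσσ : ∀ a, σ (σ a) = a) (c : F) : σ (algebraMap F A c) = algebraMap F A c := by
  rw [Algebra.algebraMap_eq_smul_one, map_smul, involution_one hσmul hσσ]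

variable [CharP A 2]

/-- A nonzero subspace stable under two quaternion algebras acting from the left and the right
contains a nonzero element intertwining their generators. -/
theorem exists_intertwiner {x y x' y' : A} {α β : F} (hx : x ^ 2 + x = algebraMap F A α)
    (hy : y ^ 2 = algebraMap F A β) (hxy : x * y + y * x = y) (hy0 : y ≠ 0)
    (hx' : x' ^ 2 + x' = algebraMap F A α) (hy' : y' ^ 2 = algebraMap F A β)
    (hxy' : x' * y' + y' * x' = y') (P : Submodule F A) (hPx : ∀ m ∈ P, x * m ∈ P)
    (hPy : ∀ m ∈ P, y * m ∈ P) (hPx' : ∀ m ∈ P, m * x' ∈ P) (hPy' : ∀ m ∈ P, m * y' ∈ P)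
    {m : A} (hm : m ∈ P) (hm0 : m ≠ 0) :
    ∃ n ∈ P, n ≠ 0 ∧ x * n + n * x' = n ∧ y * n = n * y' := by
  have two (a : A) : a + a = 0 := CharTwo.add_self_eq_zero a
  have hyx : y * x = x * y + y := by
    calc y * x = x * y + (x * y + y * x) := by rw [← add_assoc, two, zero_add]
      _ = _ := by rw [hxy]
  have hyx' : y' * x' = x' * y' + y' := by
    calc y' * x' = x' * y' + (x' * y' + y' * x') := by rw [← add_assoc, two, zero_add]
      _ = _ := by rw [hxy']
  have hxx : x * x = algebraMap F A α + x := by rw [← hx, add_assoc, two, add_zero, sq]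
  have hxx' : x' * x' = algebraMap F A α + x' := by rw [← hx', add_assoc, two, add_zero, sq]
  have hy'0 : y' ≠ 0 := by
    rintro rfl
    rw [zero_pow two_ne_zero, ← hy] at hy'
    exact pow_ne_zero 2 hy0 hy'.symm
  -- If k ↦ xk + kx' vanished at both m and ym, then (xy + yx)m = ym would be zero.
  obtain ⟨k, hk, hk0⟩ : ∃ k ∈ P, x * k + k * x' ≠ 0 := by
    by_contra! hcon
    have h1 := hcon m hm
    have h2 := hcon (y * m) (hPy m hm)
    have h3 : m * x' = x * m := by rw [← CharTwo.add_eq_zero, add_comm, h1]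
    rw [mul_assoc, h3, ← mul_assoc, ← mul_assoc, ← add_mul, hxy] at h2
    exact mul_ne_zero hy0 hm0 h2
  -- The operator k ↦ xk + kx' is idempotent because x and x' have the same α, so it fixes its
  -- values.
  obtain ⟨M, hM, hM0, hMx⟩ : ∃ M ∈ P, M ≠ 0 ∧ x * M + M * x' = M := by
    refine ⟨_, add_mem (hPx k hk) (hPx' k hk), hk0, ?_⟩
    calc x * (x * k + k * x') + (x * k + k * x') * x'
        = x * x * k + k * (x' * x') + (x * k * x' + x * k * x') := by noncomm_ring
      _ = x * k + k * x' + (algebraMap F A α * k + k * algebraMap F A α) := by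
          rw [hxx, hxx', two]; noncomm_ring
      _ = _ := by rw [← Algebra.commutes, two, add_zero]
  have key : ∀ M ∈ P, x * M + M * x' = M → β • M + y * M * y' ≠ 0 →
      ∃ n ∈ P, n ≠ 0 ∧ x * n + n * x' = n ∧ y * n = n * y' := by
    intro M hM hMx h0
    refine ⟨_, add_mem (P.smul_mem β hM) (hPy' _ (hPy _ hM)), h0, ?_, ?_⟩
    · have h1 : x * (y * M * y') + y * M * y' * x' = y * M * y' := by
        calc x * (y * M * y') + y * M * y' * x'
            = x * y * M * y' + y * M * (y' * x') := by noncomm_ring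
          _ = (x * y + y) * M * y' + y * M * x' * y' + (y * M * y' - y * M * y') := by
              rw [hyx']; noncomm_ring
          _ = y * (x * M + M * x') * y' := by rw [← hyx]; noncomm_ring
          _ = _ := by rw [hMx]
      calc x * (β • M + y * M * y') + (β • M + y * M * y') * x'
          = β • (x * M + M * x') + (x * (y * M * y') + y * M * y' * x') := by
            rw [mul_add, add_mul, mul_smul_comm, smul_mul_assoc, smul_add]; abel
        _ = _ := by rw [h1, hMx]
    · calc y * (β • M + y * M * y') = β • (y * M) + y ^ 2 * (M * y') := by
            rw [mul_add, mul_smul_comm, sq]; noncomm_ring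
        _ = β • (M * y') + y * M * y' ^ 2 := by
            rw [hy, hy', ← Algebra.smul_def, ← Algebra.commutes, ← Algebra.smul_def, add_comm]
        _ = _ := by rw [add_mul, smul_mul_assoc, sq]; noncomm_ring
  -- The average βM + yMy' intertwines y and y'. If it vanishes for M, then for xM it equals yMy',
  -- which is nonzero.
  by_cases h0 : β • M + y * M * y' = 0
  · refine key (x * M) (hPx M hM) ?_ ?_
    · rw [mul_assoc, ← mul_add, hMx]
    · have h1 : β • (x * M) + y * (x * M) * y' = y * M * y' := by
        calc β • (x * M) + y * (x * M) * y' = β • (x * M) + y * x * M * y' := by noncomm_ring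
          _ = x * (β • M + y * M * y') + y * M * y' := by
              rw [hyx, mul_add, mul_smul_comm]; noncomm_ring
          _ = _ := by rw [h0, mul_zero, zero_add]
      rw [h1]
      exact mul_ne_zero (mul_ne_zero hy0 hM0) hy'0
  · exact key M hM hMx h0

/-- The intertwiners for (x, y) form a subspace stable under z, u on the left and σ z, σ u on the
right, since these commute with the first pair and its image. Averaging inside it handles the second
pair. -/
theorem OrderedQuadruple.exists_intertwiner (hfin : Module.finrank F A = 16) {σ : A →ₗ[F] A}
    (hσmul : ∀ a b, σ (a * b) = σ b * σ a) (hσσ : ∀ a, σ (σ a) = a) (q : OrderedQuadruple F A) :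
    ∃ s, s ≠ 0 ∧ σ s = s ∧ q.x * s + s * σ q.x = s ∧ q.y * s = s * σ q.y ∧
      q.z * s + s * σ q.z = s ∧ q.u * s = s * σ q.u := by
  have hy0 := q.y_ne_zero hfin
  have hu0 := q.u_ne_zero hfin
  have hxz := q.xz_eq_zx
  have hxu := q.xu_eq_ux
  have hyz := q.yz_eq_zy
  have hyu := q.yu_eq_uy
  obtain ⟨α, hα⟩ := q.artinSchreier_x
  obtain ⟨β, hβ⟩ := q.squareCentral_y
  obtain ⟨γ, hγ⟩ := q.artinSchreier_z
  obtain ⟨δ, hδ⟩ := q.squareCentral_u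
  have hAS : ∀ (a : A) (c : F), a ^ 2 + a = algebraMap F A c →
      σ a ^ 2 + σ a = algebraMap F A c := by
    intro a c h
    rw [sq, ← hσmul, ← map_add, ← sq, h, involution_algebraMap hσmul hσσ]
  have hSC : ∀ (a : A) (c : F), a ^ 2 = algebraMap F A c → σ a ^ 2 = algebraMap F A c := by
    intro a c h
    rw [sq, ← hσmul, ← sq, h, involution_algebraMap hσmul hσσ]
  have hrel : ∀ a b : A, a * b + b * a = b → σ a * σ b + σ b * σ a = σ b := by
    intro a b h
    rw [← hσmul, ← hσmul, ← map_add, add_comm, h]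
  have hcm : ∀ a b : A, a * b = b * a → σ a * σ b = σ b * σ a := by
    intro a b h
    rw [← hσmul, ← hσmul, h]
  obtain ⟨N, -, hN0, hNx, hNy⟩ := Biquaternion.exists_intertwiner hα hβ q.xy_add_yx hy0
    (hAS _ _ hα) (hSC _ _ hβ) (hrel _ _ q.xy_add_yx) ⊤ (fun _ _ => trivial) (fun _ _ => trivial)
    (fun _ _ => trivial) (fun _ _ => trivial) (Submodule.mem_top (x := (1 : A))) one_ne_zero
  let P : Submodule F A :=
    { carrier := {n | q.x * n + n * σ q.x = n ∧ q.y * n = n * σ q.y}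
      zero_mem' := by simp
      add_mem' := by
        rintro a b ⟨h1, h2⟩ ⟨h3, h4⟩
        refine ⟨?_, by rw [mul_add, add_mul, h2, h4]⟩
        rw [mul_add, add_mul, add_add_add_comm, h1, h3]
      smul_mem' := by
        rintro c a ⟨h1, h2⟩
        refine ⟨?_, by rw [mul_smul_comm, smul_mul_assoc, h2]⟩
        rw [mul_smul_comm, smul_mul_assoc, ← smul_add, h1] }
  have hl : ∀ t, q.x * t = t * q.x → q.y * t = t * q.y → ∀ n ∈ P, t * n ∈ P := by
    rintro t h1 h2 n ⟨h3, h4⟩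
    refine ⟨?_, ?_⟩
    · rw [← mul_assoc, h1, mul_assoc, mul_assoc, ← mul_add, h3]
    · rw [← mul_assoc, h2, mul_assoc, h4, mul_assoc]
  have hr : ∀ t, q.x * t = t * q.x → q.y * t = t * q.y → ∀ n ∈ P, n * σ t ∈ P := by
    rintro t h1 h2 n ⟨h3, h4⟩
    refine ⟨?_, ?_⟩
    · rw [mul_assoc, ← hcm _ _ h1, ← mul_assoc, ← mul_assoc, ← add_mul, h3]
    · rw [mul_assoc, ← hcm _ _ h2, ← mul_assoc, h4, mul_assoc]
  obtain ⟨s, ⟨hsx, hsy⟩, hs0, hsz, hsu⟩ := Biquaternion.exists_intertwiner hγ hδ q.zu_add_uz hu0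
    (hAS _ _ hγ) (hSC _ _ hδ) (hrel _ _ q.zu_add_uz) P (hl _ hxz hyz) (hl _ hxu hyu)
    (hr _ hxz hyz) (hr _ hxu hyu) (m := N) ⟨hNx, hNy⟩ hN0
  by_cases hs : σ s = s
  · exact ⟨s, hs0, hs, hsx, hsy, hsz, hsu⟩
  -- Applying σ to each relation gives the same relation for σ s. Hence s + σ s, nonzero when s is
  -- not fixed, is a σ-fixed solution.
  have h1 : ∀ a, a * s + s * σ a = s → a * (s + σ s) + (s + σ s) * σ a = s + σ s := by
    intro a h
    have h' : a * σ s + σ s * σ a = σ s := by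
      have := congrArg σ h
      rwa [map_add, hσmul, hσmul, hσσ, add_comm] at this
    rw [mul_add, add_mul, add_add_add_comm, h, h']
  have h2 : ∀ a, a * s = s * σ a → a * (s + σ s) = (s + σ s) * σ a := by
    intro a h
    have h' : a * σ s = σ s * σ a := by
      have := congrArg σ h
      rw [hσmul, hσmul, hσσ] at this
      exact this.symm
    rw [mul_add, add_mul, h, h']
  refine ⟨s + σ s, ?_, by rw [map_add, hσσ, add_comm], h1 _ hsx, h2 _ hsy, h1 _ hsz, h2 _ hsu⟩
  rw [Ne, CharTwo.add_eq_zero]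
  exact fun h => hs h.symm

end Intertwiner

/-! ### Every quadruple comes from a frame -/

section FrameOfQuadruple

variable {F A V : Type*} [Field F] [DivisionRing A] [Algebra F A] [AddCommGroup V] [Module F V]
  {S : AlbertSpace F A V} [CharP A 2]

/-- If the linear coefficient in `bracket_sq` were nonzero, a scalar square would force the bracket
itself to be scalar. -/
theorem AlbertSpace.form_eq_zero_of_bracket_sq {v w : V} {c : F}
    (h : S.bracket v w ^ 2 = algebraMap F A c) (h' : ∀ r, S.bracket v w ≠ algebraMap F A r) :
    S.form v w = 0 := by
  by_contra hf
  rw [S.bracket_sq, ← eq_sub_iff_add_eq, ← map_sub] at h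
  refine h' ((S.form v w)⁻¹ * (c - S.quad v * S.quad w)) ?_
  rw [map_mul, ← h, ← mul_assoc, ← map_mul, inv_mul_cancel₀ hf, map_one, one_mul]

/-- A pair of generators of a quaternion subalgebra is given by a hyperbolic pair. -/
theorem AlbertSpace.exists_pair_of_generators {n a b : V} (hn : n ≠ 0) {x y : A} {α β : F}
    (hx : x ^ 2 + x = algebraMap F A α) (hy : y ^ 2 = algebraMap F A β)
    (hxy : x * y + y * x = y) (hy0 : y ≠ 0) (ha : S.i a = y * S.i n)
    (hb : S.i b = y * x * S.i n) :
    ∃ v w, S.form v w = 1 ∧ S.form v n = 0 ∧ S.form w n = 0 ∧ S.bracket v w = x ∧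
      S.bracket v n = y ∧ ∃ r : F, S.bracket w n = r • (y * x) := by
  have two (a : A) : a + a = 0 := CharTwo.add_self_eq_zero a
  have hyx : y * x = (x + 1) * y := by
    calc y * x = x * y + (x * y + y * x) := by rw [← add_assoc, two, zero_add]
      _ = _ := by rw [hxy, add_mul, one_mul]
  have hq := S.quad_ne_zero hn
  have hnp := S.i_mul_p n
  let v := (S.quad n)⁻¹ • a
  have hvn : S.bracket v n = y := by
    rw [AlbertSpace.bracket, map_smul, ha, smul_mul_assoc, mul_assoc, hnp, ← Algebra.commutes,
      ← Algebra.smul_def, smul_smul, inv_mul_cancel₀ hq, one_smul]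
  have hv0 : v ≠ 0 := by
    intro h
    rw [h, AlbertSpace.bracket, map_zero, zero_mul] at hvn
    exact hy0 hvn.symm
  have hqv := S.quad_ne_zero hv0
  -- Scaled so that [w, v] = x + 1, hence [v, w] = x; the vector b supplies it because yx = (x +
  -- 1)y.
  let w := (S.quad v)⁻¹ • (S.quad n)⁻¹ • b
  have hiw : S.i w = (S.quad v)⁻¹ • ((x + 1) * S.i v) := by
    simp only [w, v, map_smul, ha, hb, hyx, mul_smul_comm, mul_assoc]
  have hwv : S.bracket w v = x + 1 := by
    rw [AlbertSpace.bracket, hiw, smul_mul_assoc, mul_assoc, S.i_mul_p, ← Algebra.commutes,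
      ← Algebra.smul_def, smul_smul, inv_mul_cancel₀ hqv, one_smul]
  have hwn : S.bracket w n = (S.quad v)⁻¹ • (y * x) := by
    rw [AlbertSpace.bracket, hiw, hyx, smul_mul_assoc, mul_assoc, ← AlbertSpace.bracket, hvn]
  -- Since x + 1 is not scalar, its two monic quadratic equations have the same linear coefficient.
  have hform : S.form w v = 1 := by
    by_contra hf
    have h1 := S.bracket_sq w v
    have h2 : (x + 1) ^ 2 = x + 1 + algebraMap F A α := by
      calc (x + 1) ^ 2 = 1 + (x ^ 2 + x) + x := by noncomm_ring
        _ = _ := by rw [hx]; abel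
    rw [hwv, h2] at h1
    have h3 : algebraMap F A (1 - S.form w v) * (x + 1) =
        algebraMap F A (S.quad w * S.quad v - α) := by
      rw [map_sub, map_sub, sub_mul, map_one, one_mul, sub_eq_sub_iff_add_eq_add, h1, add_comm]
    have hf' : 1 - S.form w v ≠ 0 := fun h => hf (sub_eq_zero.1 h).symm
    refine not_mem_range_of_artinSchreier hxy hy0
      ((1 - S.form w v)⁻¹ * (S.quad w * S.quad v - α) - 1) ?_
    rw [map_sub, map_mul, ← h3, ← mul_assoc, ← map_mul, inv_mul_cancel₀ hf', map_one, one_mul,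
      add_sub_cancel_right]
  have hcomm : x * y ≠ y * x := by
    intro h
    rw [h, two] at hxy
    exact hy0 hxy.symm
  refine ⟨v, w, by rw [S.form_comm, hform], ?_, ?_, ?_, hvn, _, hwn⟩
  · refine AlbertSpace.form_eq_zero_of_bracket_sq (by rw [hvn, hy]) fun r h => hcomm ?_
    rw [← hvn, h, Algebra.commutes]
  · have h1 : (y * x) ^ 2 = algebraMap F A (β * α) := by
      have hxy' : x * y = y * x + y := by
        calc x * y = y * x + (x * y + y * x) := by rw [add_left_comm, two, add_zero]
          _ = _ := by rw [hxy]
      calc (y * x) ^ 2 = y * (x * y) * x := by rw [sq]; noncomm_ring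
        _ = y ^ 2 * (x ^ 2 + x) := by rw [hxy']; noncomm_ring
        _ = _ := by rw [hx, hy, map_mul]
    refine AlbertSpace.form_eq_zero_of_bracket_sq (c := (S.quad v)⁻¹ ^ 2 * (β * α))
      (by rw [hwn, smul_pow, h1, Algebra.smul_def, ← map_mul]) fun r h => ?_
    rw [hwn] at h
    have h2 : y * x = algebraMap F A (S.quad v * r) := by
      rw [map_mul, ← h, ← Algebra.smul_def, smul_smul, mul_inv_cancel₀ hqv, one_smul]
    refine hcomm (mul_left_cancel₀ hy0 ?_)
    rw [← mul_assoc, h2, Algebra.commutes, ← h2]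
  · rw [AlbertSpace.bracket, S.i_mul_p_swap, ← AlbertSpace.bracket, hwv, S.form_comm, hform,
      map_one, add_comm, add_assoc, two, add_zero]

theorem OrderedQuadruple.exists_frame (hfin : Module.finrank F A = 16) {σ : A →ₗ[F] A}
    (hσmul : ∀ a b, σ (a * b) = σ b * σ a) (hσσ : ∀ a, σ (σ a) = a)
    (hS : ∀ a, ∃ v, S.i v = a + σ a) (q : OrderedQuadruple F A) :
    ∃ f : Frame S, f.toOrderedQuadruple hfin = q := by
  obtain ⟨s, hs0, hσs, hsx, hsy, hsz, hsu⟩ := q.exists_intertwiner hfin hσmul hσσ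
  have hy0 := q.y_ne_zero hfin
  have hu0 := q.u_ne_zero hfin
  have hxz := q.xz_eq_zx
  have hxu := q.xu_eq_ux
  have hyz := q.yz_eq_zy
  have hyu := q.yu_eq_uy
  obtain ⟨α, hα⟩ := q.artinSchreier_x
  obtain ⟨β, hβ⟩ := q.squareCentral_y
  obtain ⟨γ, hγ⟩ := q.artinSchreier_z
  obtain ⟨δ, hδ⟩ := q.squareCentral_u
  -- Here gs is σ-fixed, and gs = g(ts + sσ(t)) = tgs + σ(tgs) is a symmetrized element, so it lies
  -- in i(V). For g from one pair, t is taken from the other.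
  have hmem : ∀ t g : A, t * s + s * σ t = s → t * g = g * t → g * s = s * σ g →
      ∃ v, S.i v = g * s := by
    intro t g ht htg hg
    obtain ⟨v, hv⟩ := hS (t * (g * s))
    refine ⟨v, hv.trans ?_⟩
    rw [hσmul, hσmul, hσs, ← hg, ← mul_assoc, htg, mul_assoc, mul_assoc, ← mul_add, ht]
  have hmul : ∀ a b : A, a * s + s * σ a = s → b * s = s * σ b → a * b + b * a = b →
      b * a * s = s * σ (b * a) := by
    intro a b ha hb hab
    have ha' : s * σ a = a * s + s := by
      calc s * σ a = a * s + (a * s + s * σ a) := by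
            rw [← add_assoc, CharTwo.add_self_eq_zero, zero_add]
        _ = _ := by rw [ha]
    calc b * a * s = a * b * s + (a * b + b * a) * s := by
          rw [add_mul, ← add_assoc, CharTwo.add_self_eq_zero, zero_add]
      _ = a * (s * σ b) + s * σ b := by rw [hab, mul_assoc, hb]
      _ = (a * s + s) * σ b := by rw [add_mul, mul_assoc]
      _ = _ := by rw [← ha', hσmul, mul_assoc]
  obtain ⟨n, hn⟩ := hmem q.x 1 hsx (by simp) (by simp [involution_one hσmul hσσ])
  rw [one_mul] at hn
  have hn0 : n ≠ 0 := by
    rintro rfl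
    exact hs0 (by rw [← hn, map_zero])
  obtain ⟨a, ha⟩ := hmem q.z q.y hsz hyz.symm hsy
  obtain ⟨b, hb⟩ := hmem q.z (q.y * q.x) hsz
    (by rw [← mul_assoc, ← hyz, mul_assoc, ← hxz, mul_assoc]) (hmul _ _ hsx hsy q.xy_add_yx)
  obtain ⟨c, hc⟩ := hmem q.x q.u hsx hxu hsu
  obtain ⟨d, hd⟩ := hmem q.x (q.u * q.z) hsx
    (by rw [← mul_assoc, hxu, mul_assoc, hxz, mul_assoc]) (hmul _ _ hsz hsu q.zu_add_uz)
  rw [← hn] at ha hb hc hd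
  obtain ⟨v, w, hvw, hvn, hwn, hx, hy, r, hr⟩ :=
    AlbertSpace.exists_pair_of_generators hn0 hα hβ q.xy_add_yx hy0 ha hb
  obtain ⟨v', w', hvw', hvn', hwn', hz, hu, r', hr'⟩ :=
    AlbertSpace.exists_pair_of_generators hn0 hγ hδ q.zu_add_uz hu0 hc hd
  -- Orthogonality of the two pairs is read off from commuting brackets with n, which are y, u and
  -- multiples of yx, uz.
  have horth : ∀ k l, S.form k n = 0 → S.form l n = 0 →
      Commute (S.bracket k n) (S.bracket l n) → S.form k l = 0 := fun k l hk hl h =>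
    (S.bracket_commute_same_iff hn0 (by rw [S.form_comm, hk]) (by rw [S.form_comm, hl])).1 h.eq
  have cxz : Commute q.x q.z := hxz
  have cxu : Commute q.x q.u := hxu
  have cyz : Commute q.y q.z := hyz
  have cyu : Commute q.y q.u := hyu
  refine ⟨⟨v, w, v', w', n, hvw, hvw', horth _ _ hvn hvn' ?_, horth _ _ hvn hwn' ?_,
    horth _ _ hwn hvn' ?_, horth _ _ hwn hwn' ?_, hvn, hwn, hvn', hwn', hn0⟩, ?_⟩
  · rw [hy, hu]; exact cyu
  · rw [hy, hr']; exact (cyu.mul_right cyz).smul_right _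
  · rw [hu, hr]; exact (cyu.mul_left cxu).smul_left _
  · rw [hr, hr']
    exact (((cyu.mul_right cyz).mul_left (cxu.mul_right cxz)).smul_left _).smul_right _
  · exact OrderedQuadruple.ext hx hy hz hu

end FrameOfQuadruple

/-! ### From chains to sequences keeping two entries -/

theorem stepKeepsTwo_of_stepPi {F A : Type*} [Field F] [Ring A] [Algebra F A]
    {p p' : Quadruple F A} (h : StepPi p p') : StepKeepsTwo p p' := by
  obtain ⟨q, q', h1, h2, h3⟩ := h
  refine ⟨q, q', h1, h2, ?_⟩
  rcases h3 with h3 | h3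
  · exact ⟨0, 1, by decide, h3.1, h3.2⟩
  · exact ⟨2, 3, by decide, h3.1, h3.2⟩

theorem stepKeepsTwo_of_stepLambdaTwo {F A : Type*} [Field F] [Ring A] [Algebra F A]
    {p p' : Quadruple F A} (h : StepLambdaTwo p p') : StepKeepsTwo p p' := by
  obtain ⟨q, q', h1, h2, h3, h4⟩ := h
  refine ⟨q, q', h1, h2, ?_⟩
  rcases h3 with h3 | h3 <;> rcases h4 with h4 | h4
  · exact ⟨0, 2, by decide, h3, h4⟩
  · exact ⟨0, 3, by decide, h3, h4⟩
  · exact ⟨1, 2, by decide, h3, h4⟩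
  · exact ⟨1, 3, by decide, h3, h4⟩

theorem exists_sequence_succ {X : Type*} {r : X → X → Prop} {n : ℕ} {a b c : X}
    (h : ∃ f : ℕ → X, f 0 = a ∧ f n = b ∧ ∀ i < n, r (f i) (f (i + 1))) (hbc : r b c) :
    ∃ f : ℕ → X, f 0 = a ∧ f (n + 1) = c ∧ ∀ i < n + 1, r (f i) (f (i + 1)) := by
  obtain ⟨f, h0, hn, hr⟩ := h
  refine ⟨fun i => if i ≤ n then f i else c, by simp [h0], by simp, fun i hi => ?_⟩
  rcases Nat.lt_succ_iff_lt_or_eq.1 hi with h | rfl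
  · simpa [h.le, Nat.succ_le_of_lt h] using hr i h
  · simpa [hn] using hbc

theorem Chain.exists_sequence {F A : Type*} [Field F] [Ring A] [Algebra F A] {m n : ℕ}
    {p p' : Quadruple F A} (h : Chain m n p p') : ∃ c : ℕ → Quadruple F A,
      c 0 = p ∧ c (m + n) = p' ∧ ∀ i < m + n, StepKeepsTwo (c i) (c (i + 1)) := by
  induction h with
  | nil p => exact ⟨fun _ => p, rfl, rfl, by simp⟩
  | stepPi _ hs ih =>
    rw [Nat.add_right_comm]
    exact exists_sequence_succ ih (stepKeepsTwo_of_stepPi hs)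
  | stepLambdaTwo _ hs ih =>
    exact exists_sequence_succ ih (stepKeepsTwo_of_stepLambdaTwo hs)

end Biquaternion

theorem mainTheorem3 {F A : Type*} [Field F] [CharP F 2] [DivisionRing A] [Algebra F A]
    (hA : Biquaternion.IsBiquaternionAlgebra F A) (p p' : Biquaternion.Quadruple F A) :
    (∃ m n : ℕ, m ≤ 9 ∧ n ≤ 6 ∧ Biquaternion.Chain m n p p') ∧
    (∃ n : ℕ, n ≤ 15 ∧ ∃ c : ℕ → Biquaternion.Quadruple F A,
      c 0 = p ∧ c n = p' ∧ ∀ i < n, Biquaternion.StepKeepsTwo (c i) (c (i + 1))) := by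
  have : CharP A 2 := charP_of_injective_algebraMap (algebraMap F A).injective 2
  obtain ⟨S, σ, hσmul, hσσ, hS⟩ := hA.exists_albertSpace
  obtain ⟨q, rfl⟩ := Quotient.exists_rep p
  obtain ⟨q', rfl⟩ := Quotient.exists_rep p'
  obtain ⟨f, rfl⟩ := q.exists_frame hA.finrank_eq hσmul hσσ hS
  obtain ⟨g, rfl⟩ := q'.exists_frame hA.finrank_eq hσmul hσσ hS
  have h := f.chain_nine_six hA.finrank_eq g
  exact ⟨⟨9, 6, le_rfl, le_rfl, h⟩, 15, le_rfl, h.exists_sequence⟩
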